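/- Let $M$ be a compact (Hausdorff, boundaryless, not necessarily connected or orientable) smooth manifold of dimension $n$, with a smooth Riemannian metric $g_0$ whose Riemannian volume measure $\mu_{g_0}$ has total mass $1$. For $p\in M$ let $E_p=S^2_+T_p^*M$ be the set of positive definite symmetric bilinear forms on $T_pM$, with the Riemannian metric $$\langle a,b\rangle_{h,p}=\operatorname{tr}(h^{-1}ah^{-1}b)\,\sqrt{\det(g_0(p)^{-1}h)},\qquad h\in E_p,\ a,b\in T_hE_p\cong S^2T_p^*M .$$ Let $d_p$ be the induced Riemannian distance on $E_p$ and let $(\bar E_p,d_p)$ be the metric completion of $(E_p,d_p)$. Let $P(n)$ be the space of positive definite symmetric $n\times n$ matrices with the distance $d_{P(n)}$ induced by $\langle A,B\rangle_H=\operatorname{tr}(H^{-1}AH^{-1}B)\sqrt{\det H}$, and let $\bar P(n)$ be its completion. The spaces $\bar E_p$ are the fibers of a bundle $\bar E$ over $M$ with fiber $\bar P(n)$, whose local trivializations are the extensions to the completions of the maps sending a form in $E_p$ to its matrix in a chart of $M$. Let $\bar{\mathcal E}_{L^2}$ be the set of Borel measurable sections $\sigma$ of $\bar E$ such that $$\int_M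 d_p(\sigma(p),g_0(p))^2\,d\mu_{g_0}(p)<\infty ,$$ modulo equality $\mu_{g_0}$-almost everywhere, with the distance $$d_{L^2}(\sigma,\sigma')=\Big(\int_M d_p(\sigma(p),\sigma'(p))^2\,d\mu_{g_0}(p)\Big)^{1/2}.$$ Then the set $\mathcal E_{C^\infty}$ of smooth Riemannian metrics on $M$ is contained in $\bar{\mathcal E}_{L^2}$ (that is, each smooth metric, viewed as a section of $\bar E$, is Borel measurable and square integrable) and is dense in it with respect to $d_{L^2}$. -/

import Mathlib

open Set MeasureTheory Bundle Manifold
open scoped ENNReal ContDiff Topology Matrix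

noncomputable section

namespace EbinL2

/-! ### Positive definite symmetric bilinear forms and their Riemannian metric -/

section Forms

variable {V : Type*} [AddCommGroup V] [Module ℝ V]

/-- A positive definite symmetric bilinear form on the real vector space `V`, i.e. an element of
`S²₊ V*`. -/
structure PosForm (V : Type*) [AddCommGroup V] [Module ℝ V] where
  form : LinearMap.BilinForm ℝ V
  symm (v w : V) : form v w = form w v
  pos (v : V) (hv : v ≠ 0) : 0 < form v v

theorem PosForm.nondegenerate (h : PosForm V) : h.form.Nondegenerate := by
  refine ⟨fun v hv => ?_, fun v hv => ?_⟩
  · by_contra hne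
    exact (h.pos v hne).ne' (hv v)
  · by_contra hne
    exact (h.pos v hne).ne' (hv v)

/-- The pull-back `(u, v) ↦ h (e⁻¹ u, e⁻¹ v)` of a positive definite form by the inverse of a
linear isomorphism `e : V → W`. -/
def PosForm.push {W : Type*} [AddCommGroup W] [Module ℝ W] (e : V ≃ₗ[ℝ] W) (h : PosForm V) :
    PosForm W where
  form := h.form.compl₁₂ e.symm.toLinearMap e.symm.toLinearMap
  symm v w := h.symm _ _
  pos v hv := h.pos _ (by simpa using hv)

variable [FiniteDimensional ℝ V]

/-- The endomorphism `h⁻¹ a` of `V`, where `h` and `a` are regarded as linear maps from `V` to its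
dual. -/
def PosForm.invComp (h : PosForm V) (a : LinearMap.BilinForm ℝ V) : V →ₗ[ℝ] V :=
  (h.form.toDual h.nondegenerate).symm.toLinearMap ∘ₗ a

/-- The scalar product `⟨a, b⟩_h = tr (h⁻¹ a h⁻¹ b) * √(det (g₀⁻¹ h))` on `T_h (S²₊ V*) = S² V*`. -/
def ebinInner (g₀ h : PosForm V) (a b : LinearMap.BilinForm ℝ V) : ℝ :=
  LinearMap.trace ℝ V (h.invComp a ∘ₗ h.invComp b) * √(LinearMap.det (g₀.invComp h.form))

/-- `γ` restricted to `[0, 1]` is a `C¹` path in `S²₊ V*` from `h` to `k` with velocity `γ'`.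
As `V` is finite dimensional, differentiability and continuity of maps with values in bilinear forms
are tested on the values of the forms. -/
structure IsC1Path (γ : ℝ → PosForm V) (γ' : ℝ → LinearMap.BilinForm ℝ V) (h k : PosForm V) :
    Prop where
  source : γ 0 = h
  target : γ 1 = k
  hasDeriv (t : ℝ) (ht : t ∈ Icc (0 : ℝ) 1) (v w : V) :
    HasDerivWithinAt (fun s => (γ s).form v w) (γ' t v w) (Icc 0 1) t
  cont (v w : V) : ContinuousOn (fun t => γ' t v w) (Icc 0 1)

/-- The length of a `C¹` path for the Riemannian metric `ebinInner g₀`. -/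
def ebinLength (g₀ : PosForm V) (γ : ℝ → PosForm V) (γ' : ℝ → LinearMap.BilinForm ℝ V) : ℝ≥0∞ :=
  ∫⁻ t in Icc (0 : ℝ) 1, ENNReal.ofReal (√(ebinInner g₀ (γ t) (γ' t) (γ' t)))

/-- The Riemannian distance: the infimum of the lengths of the `C¹` paths. -/
def ebinEDist (g₀ h k : PosForm V) : ℝ≥0∞ :=
  ⨅ (γ : ℝ → PosForm V) (γ' : ℝ → LinearMap.BilinForm ℝ V) (_ : IsC1Path γ γ' h k),
    ebinLength g₀ γ γ'

theorem invComp_smul (h : PosForm V) (c : ℝ) (a : LinearMap.BilinForm ℝ V) :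
    h.invComp (c • a) = c • h.invComp a := by
  simp [PosForm.invComp, LinearMap.comp_smul]

theorem ebinInner_smul (g₀ h : PosForm V) (c : ℝ) (a : LinearMap.BilinForm ℝ V) :
    ebinInner g₀ h (c • a) (c • a) = c ^ 2 * ebinInner g₀ h a a := by
  simp only [ebinInner, invComp_smul, LinearMap.comp_smul, LinearMap.smul_comp, map_smul,
    smul_eq_mul]
  ring

theorem speed_smul (g₀ h : PosForm V) {c : ℝ} (hc : 0 ≤ c) (a : LinearMap.BilinForm ℝ V) :
    ENNReal.ofReal (√(ebinInner g₀ h (c • a) (c • a))) =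
      ENNReal.ofReal c * ENNReal.ofReal (√(ebinInner g₀ h a a)) := by
  rw [ebinInner_smul, Real.sqrt_mul (sq_nonneg c), Real.sqrt_sq hc, ENNReal.ofReal_mul hc]

theorem ebinEDist_self (g₀ h : PosForm V) : ebinEDist g₀ h h = 0 := by
  refine le_antisymm ?_ bot_le
  refine (iInf₂_le_of_le (fun _ => h) (fun _ => 0) (iInf_le_of_le
    ⟨rfl, rfl, fun t _ v w => by simpa using hasDerivWithinAt_const _ _ _,
      fun v w => by simpa using continuousOn_const⟩ le_rfl)).trans ?_
  simp [ebinLength, ebinInner, PosForm.invComp]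

theorem ebinEDist_comm_le (g₀ h k : PosForm V) : ebinEDist g₀ k h ≤ ebinEDist g₀ h k := by
  refine le_iInf₂ fun γ γ' => le_iInf fun hγ => ?_
  have hmaps : MapsTo (fun t : ℝ => 1 - t) (Icc 0 1) (Icc 0 1) := by
    intro t ht; exact ⟨by linarith [ht.2], by linarith [ht.1]⟩
  have hrev : IsC1Path (fun t => γ (1 - t)) (fun t => -γ' (1 - t)) k h := by
    refine ⟨by simpa using hγ.target, by simpa using hγ.source, fun t ht v w => ?_, fun v w => ?_⟩
    · have h1 := hγ.hasDeriv (1 - t) (hmaps ht) v w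
      have h2 : HasDerivWithinAt (fun t : ℝ => 1 - t) (-1) (Icc 0 1) t := by
        simpa using (hasDerivWithinAt_id t (Icc (0 : ℝ) 1)).const_sub 1
      have h3 := HasDerivWithinAt.comp t h1 h2 hmaps
      simpa [Function.comp_def] using h3
    · have h2 : ContinuousOn (fun t : ℝ => 1 - t) (Icc 0 1) := by fun_prop
      have h3 := ((hγ.cont v w).comp h2 hmaps).neg
      exact h3
  refine (iInf₂_le_of_le _ _ (iInf_le _ hrev)).trans ?_
  · have hneg : ∀ (p : PosForm V) (a : LinearMap.BilinForm ℝ V),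
        ebinInner g₀ p (-a) (-a) = ebinInner g₀ p a a := fun p a => by
      have := ebinInner_smul g₀ p (-1) a
      rwa [show (-1 : ℝ) • a = -a by ext v w; simp, neg_one_sq, one_mul] at this
    simp only [ebinLength, hneg]
    have hmp : MeasurePreserving (fun t : ℝ => 1 - t) volume volume :=
      Measure.measurePreserving_sub_left volume 1
    have hme : MeasurableEmbedding (fun t : ℝ => 1 - t) :=
      (Homeomorph.subLeft (1 : ℝ)).measurableEmbedding
    have hpre : (fun t : ℝ => 1 - t) ⁻¹' (Icc 0 1) = Icc 0 1 := by
      ext t; simp only [mem_preimage, mem_Icc]; constructor <;> rintro ⟨h1, h2⟩ <;>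
        constructor <;> linarith
    have := hmp.setLIntegral_comp_preimage_emb hme
      (fun t => ENNReal.ofReal (√(ebinInner g₀ (γ t) (γ' t) (γ' t)))) (Icc 0 1)
    rw [hpre] at this
    exact this.le

theorem lintegral_reparam (g₀ : PosForm V) (γ : ℝ → PosForm V) (γ' : ℝ → LinearMap.BilinForm ℝ V)
    {a b : ℝ} (hab : a ≤ b) {f f' : ℝ → ℝ} (hf : ∀ t ∈ Icc a b, HasDerivWithinAt f (f' t) (Icc a b) t)
    (hmono : MonotoneOn f (Icc a b)) (hf' : ∀ t ∈ Icc a b, 0 ≤ f' t) (fa : f a = 0) (fb : f b = 1) :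
    ∫⁻ t in Icc a b, ENNReal.ofReal
      (√(ebinInner g₀ (γ (f t)) (f' t • γ' (f t)) (f' t • γ' (f t)))) = ebinLength g₀ γ γ' := by
  have him : f '' Icc a b = Icc 0 1 := by
    rw [ContinuousOn.image_Icc_of_monotoneOn hab
      (fun t ht => (hf t ht).continuousWithinAt) hmono, fa, fb]
  rw [ebinLength, ← him,
    lintegral_image_eq_lintegral_deriv_mul_of_monotoneOn measurableSet_Icc hf hmono]
  exact setLIntegral_congr_fun measurableSet_Icc fun t ht => speed_smul _ _ (hf' t ht) _

theorem ebinEDist_triangle (g₀ h k l : PosForm V) :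
    ebinEDist g₀ h l ≤ ebinEDist g₀ h k + ebinEDist g₀ k l := by
  refine ENNReal.le_of_forall_pos_le_add fun ε hε hfin => ?_
  have hε2 : (0 : ℝ≥0∞) < ε / 2 := by
    simpa using hε.ne'
  have hfin' := ENNReal.add_lt_top.1 hfin
  have key : ∀ {p q : PosForm V}, ebinEDist g₀ p q < ⊤ →
      ∃ γ γ', IsC1Path γ γ' p q ∧ ebinLength g₀ γ γ' < ebinEDist g₀ p q + ε / 2 := by
    intro p q hpq
    have := ENNReal.lt_add_right hpq.ne hε2.ne'
    nth_rw 1 [ebinEDist] at this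
    simp only [iInf_lt_iff, exists_prop] at this
    exact this
  obtain ⟨γ₁, γ₁', h₁, l₁⟩ := key hfin'.1
  obtain ⟨γ₂, γ₂', h₂, l₂⟩ := key hfin'.2
  -- a reparametrization with vanishing speed at the ends
  let η : ℝ → ℝ := fun t => 3 * t ^ 2 - 2 * t ^ 3
  let f₁ : ℝ → ℝ := fun t => 12 * t ^ 2 - 16 * t ^ 3
  let f₁' : ℝ → ℝ := fun t => 24 * t - 48 * t ^ 2
  let f₂ : ℝ → ℝ := fun t => 1 - f₁ (1 - t)
  let f₂' : ℝ → ℝ := fun t => f₁' (1 - t)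
  have d₁ : ∀ t, HasDerivAt f₁ (f₁' t) t := fun t => by
    have := ((hasDerivAt_pow 2 t).const_mul 12).sub ((hasDerivAt_pow 3 t).const_mul 16)
    exact this.congr_deriv (by simp only [f₁']; norm_num; ring)
  have d₂ : ∀ t, HasDerivAt f₂ (f₂' t) t := fun t => by
    have h2 : HasDerivAt (fun t : ℝ => 1 - t) (-1) t := by
      simpa using (hasDerivAt_id t).const_sub 1
    have := ((d₁ (1 - t)).comp t h2).const_sub 1
    exact this.congr_deriv (by simp only [f₂']; ring)
  have n₁ : ∀ t ∈ Icc (0 : ℝ) (1 / 2), 0 ≤ f₁' t := fun t ht => by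
    simp only [f₁']; nlinarith [ht.1, ht.2]
  have n₂ : ∀ t ∈ Icc (1 / 2 : ℝ) 1, 0 ≤ f₂' t := fun t ht =>
    n₁ _ ⟨by linarith [ht.2], by linarith [ht.1]⟩
  have m₁ : MonotoneOn f₁ (Icc (0 : ℝ) (1 / 2)) := by
    refine monotoneOn_of_deriv_nonneg (convex_Icc _ _)
      (fun t _ => (d₁ t).continuousAt.continuousWithinAt)
      (fun t _ => (d₁ t).differentiableAt.differentiableWithinAt) fun t ht => ?_
    rw [(d₁ t).deriv]; exact n₁ t (interior_subset ht)
  have m₂ : MonotoneOn f₂ (Icc (1 / 2 : ℝ) 1) := by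
    refine monotoneOn_of_deriv_nonneg (convex_Icc _ _)
      (fun t _ => (d₂ t).continuousAt.continuousWithinAt)
      (fun t _ => (d₂ t).differentiableAt.differentiableWithinAt) fun t ht => ?_
    rw [(d₂ t).deriv]; exact n₂ t (interior_subset ht)
  have f10 : f₁ 0 = 0 := by simp [f₁]
  have f11 : f₁ (1 / 2) = 1 := by simp only [f₁]; norm_num
  have f20 : f₂ (1 / 2) = 0 := by simp only [f₂, f₁]; norm_num
  have f21 : f₂ 1 = 1 := by simp [f₂, f₁]
  have f1h : f₁' (1 / 2) = 0 := by simp only [f₁']; norm_num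
  have f2h : f₂' (1 / 2) = 0 := by simp only [f₂', f₁']; norm_num
  have maps₁ : MapsTo f₁ (Icc (0 : ℝ) (1 / 2)) (Icc 0 1) := fun t ht =>
    ⟨f10 ▸ m₁ (left_mem_Icc.2 (by norm_num)) ht ht.1,
      f11 ▸ m₁ ht (right_mem_Icc.2 (by norm_num)) ht.2⟩
  have maps₂ : MapsTo f₂ (Icc (1 / 2 : ℝ) 1) (Icc 0 1) := fun t ht =>
    ⟨f20 ▸ m₂ (left_mem_Icc.2 (by norm_num)) ht ht.1,
      f21 ▸ m₂ ht (right_mem_Icc.2 (by norm_num)) ht.2⟩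
  let δ : ℝ → PosForm V := fun t => if t ≤ 1 / 2 then γ₁ (f₁ t) else γ₂ (f₂ t)
  let δ' : ℝ → LinearMap.BilinForm ℝ V := fun t =>
    if t ≤ 1 / 2 then f₁' t • γ₁' (f₁ t) else f₂' t • γ₂' (f₂ t)
  have e₁ : ∀ t ∈ Icc (0 : ℝ) (1 / 2), δ t = γ₁ (f₁ t) ∧ δ' t = f₁' t • γ₁' (f₁ t) :=
    fun t ht => ⟨if_pos ht.2, if_pos ht.2⟩
  have e₂ : ∀ t ∈ Icc (1 / 2 : ℝ) 1, δ t = γ₂ (f₂ t) ∧ δ' t = f₂' t • γ₂' (f₂ t) := by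
    intro t ht
    rcases ht.1.eq_or_lt with rfl | hlt
    · simp only [δ, δ', le_refl, if_true, f11, f20, f1h, f2h, zero_smul, h₁.target, h₂.source,
        and_self]
    · exact ⟨if_neg hlt.not_ge, if_neg hlt.not_ge⟩
  have D₁ : ∀ t ∈ Icc (0 : ℝ) (1 / 2), ∀ v w,
      HasDerivWithinAt (fun s => (δ s).form v w) (δ' t v w) (Icc 0 (1 / 2)) t := by
    intro t ht v w
    have := HasDerivWithinAt.comp t (h₁.hasDeriv _ (maps₁ ht) v w) (d₁ t).hasDerivWithinAt maps₁
    rw [(e₁ t ht).2]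
    refine (this.congr (fun s hs => by simp [(e₁ s hs).1]) (by simp [(e₁ t ht).1])).congr_deriv ?_
    simp [mul_comm]
  have D₂ : ∀ t ∈ Icc (1 / 2 : ℝ) 1, ∀ v w,
      HasDerivWithinAt (fun s => (δ s).form v w) (δ' t v w) (Icc (1 / 2) 1) t := by
    intro t ht v w
    have := HasDerivWithinAt.comp t (h₂.hasDeriv _ (maps₂ ht) v w) (d₂ t).hasDerivWithinAt maps₂
    rw [(e₂ t ht).2]
    refine (this.congr (fun s hs => by simp [(e₂ s hs).1]) (by simp [(e₂ t ht).1])).congr_deriv ?_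
    simp [mul_comm]
  have hU : Icc (0 : ℝ) (1 / 2) ∪ Icc (1 / 2) 1 = Icc 0 1 :=
    Icc_union_Icc_eq_Icc (by norm_num) (by norm_num)
  have C₁ : ∀ v w, ContinuousOn (fun t => δ' t v w) (Icc 0 (1 / 2)) := by
    intro v w
    have c1 : ContinuousOn f₁ (Icc (0 : ℝ) (1 / 2)) := fun t _ =>
      (d₁ t).continuousAt.continuousWithinAt
    have c2 : ContinuousOn f₁' (Icc (0 : ℝ) (1 / 2)) := by
      simp only [f₁']; fun_prop
    exact (c2.mul ((h₁.cont v w).comp c1 maps₁)).congr fun t ht => by simp [(e₁ t ht).2]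
  have C₂ : ∀ v w, ContinuousOn (fun t => δ' t v w) (Icc (1 / 2) 1) := by
    intro v w
    have c1 : ContinuousOn f₂ (Icc (1 / 2 : ℝ) 1) := fun t _ =>
      (d₂ t).continuousAt.continuousWithinAt
    have c2 : ContinuousOn f₂' (Icc (1 / 2 : ℝ) 1) := by
      simp only [f₂', f₁']; fun_prop
    exact (c2.mul ((h₂.cont v w).comp c1 maps₂)).congr fun t ht => by simp [(e₂ t ht).2]
  have hδ : IsC1Path δ δ' h l := by
    refine ⟨?_, ?_, fun t ht v w => ?_, fun v w => ?_⟩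
    · rw [(e₁ 0 ⟨le_rfl, by norm_num⟩).1, f10, h₁.source]
    · rw [(e₂ 1 ⟨by norm_num, le_rfl⟩).1, f21, h₂.target]
    · rcases lt_trichotomy t (1 / 2) with hlt | rfl | hgt
      · refine (D₁ t ⟨ht.1, hlt.le⟩ v w).mono_of_mem_nhdsWithin ?_
        filter_upwards [self_mem_nhdsWithin, mem_nhdsWithin_of_mem_nhds (Iio_mem_nhds hlt)]
          with s hs hs' using ⟨hs.1, le_of_lt hs'⟩
      · rw [← hU]
        exact (D₁ _ ⟨ht.1, le_rfl⟩ v w).union (D₂ _ ⟨le_rfl, ht.2⟩ v w)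
      · refine (D₂ t ⟨hgt.le, ht.2⟩ v w).mono_of_mem_nhdsWithin ?_
        filter_upwards [self_mem_nhdsWithin, mem_nhdsWithin_of_mem_nhds (Ioi_mem_nhds hgt)]
          with s hs hs' using ⟨le_of_lt hs', hs.2⟩
    · rw [← hU]
      exact (C₁ v w).union_of_isClosed (C₂ v w) isClosed_Icc isClosed_Icc
  have L : ebinLength g₀ δ δ' ≤ ebinLength g₀ γ₁ γ₁' + ebinLength g₀ γ₂ γ₂' := by
    rw [← lintegral_reparam g₀ γ₁ γ₁' (by norm_num) (fun t _ => (d₁ t).hasDerivWithinAt) m₁ n₁ f10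
      f11, ← lintegral_reparam g₀ γ₂ γ₂' (by norm_num) (fun t _ => (d₂ t).hasDerivWithinAt) m₂ n₂
      f20 f21, ebinLength, ← hU]
    refine (lintegral_union_le _ _ _).trans (add_le_add (le_of_eq ?_) (le_of_eq ?_))
    · exact setLIntegral_congr_fun measurableSet_Icc fun t ht => by
        simp only [(e₁ t ht).1, (e₁ t ht).2]
    · exact setLIntegral_congr_fun measurableSet_Icc fun t ht => by
        simp only [(e₂ t ht).1, (e₂ t ht).2]
  calc ebinEDist g₀ h l ≤ ebinLength g₀ δ δ' := iInf₂_le_of_le δ δ' (iInf_le _ hδ)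
    _ ≤ ebinLength g₀ γ₁ γ₁' + ebinLength g₀ γ₂ γ₂' := L
    _ ≤ (ebinEDist g₀ h k + ε / 2) + (ebinEDist g₀ k l + ε / 2) := add_le_add l₁.le l₂.le
    _ = ebinEDist g₀ h k + ebinEDist g₀ k l + (ε / 2 + ε / 2) := by abel
    _ = ebinEDist g₀ h k + ebinEDist g₀ k l + ε := by rw [ENNReal.add_halves]

theorem toMatrix_invComp {ι : Type*} [Fintype ι] [DecidableEq ι] (b : Module.Basis ι ℝ V)
    (h : PosForm V) (a : LinearMap.BilinForm ℝ V) :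
    LinearMap.toMatrix b b (h.invComp a) =
      (LinearMap.BilinForm.toMatrix b a * (LinearMap.BilinForm.toMatrix b h.form)⁻¹)ᵀ := by
  have hdet : IsUnit (LinearMap.BilinForm.toMatrix b h.form).det :=
    ((LinearMap.BilinForm.nondegenerate_iff_det_ne_zero b).1 h.nondegenerate).isUnit
  have hcl : h.form.compLeft (h.invComp a) = a := by
    ext v w
    exact LinearMap.BilinForm.apply_toDual_symm_apply (hB := h.nondegenerate) (a v) w
  have := LinearMap.BilinForm.toMatrix_compLeft b h.form (h.invComp a)
  rw [hcl] at this
  rw [this, Matrix.mul_assoc, Matrix.mul_nonsing_inv _ hdet, Matrix.mul_one,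
    Matrix.transpose_transpose]

theorem ebinEDist_lt_top (g₀ h k : PosForm V) : ebinEDist g₀ h k < ⊤ := by
  let pos : ∀ t : ℝ, t ∈ Icc (0 : ℝ) 1 → PosForm V := fun t ht =>
    { form := (1 - t) • h.form + t • k.form
      symm := fun v w => by simp [h.symm v w, k.symm v w]
      pos := fun v hv => by
        have h1 := h.pos v hv
        have h2 := k.pos v hv
        simp only [LinearMap.add_apply, LinearMap.smul_apply, smul_eq_mul]
        rcases ht.1.eq_or_lt with rfl | h0
        · simpa using h1
        · have := mul_pos h0 h2
          have := mul_nonneg (sub_nonneg.2 ht.2) h1.le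
          linarith }
  classical
  let γ : ℝ → PosForm V := fun t => if ht : t ∈ Icc (0 : ℝ) 1 then pos t ht else h
  let γ' : ℝ → LinearMap.BilinForm ℝ V := fun _ => k.form - h.form
  have eγ : ∀ t ∈ Icc (0 : ℝ) 1, (γ t).form = (1 - t) • h.form + t • k.form := fun t ht => by
    simp only [γ, dif_pos ht, pos]
  have hform : ∀ {p q : PosForm V}, p.form = q.form → p = q := by
    rintro ⟨p, _, _⟩ ⟨q, _, _⟩ hpq
    simpa using hpq
  have hγ : IsC1Path γ γ' h k := by
    refine ⟨hform ?_, hform ?_, fun t ht v w => ?_, fun v w => continuousOn_const⟩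
    · rw [eγ 0 (by simp)]; simp
    · rw [eγ 1 (by simp)]; simp
    · have : HasDerivWithinAt (fun s : ℝ => (1 - s) * h.form v w + s * k.form v w)
          ((-1) * h.form v w + 1 * k.form v w) (Icc 0 1) t :=
        (((hasDerivWithinAt_id t _).const_sub 1).mul_const _).add
          ((hasDerivWithinAt_id t _).mul_const _)
      refine (this.congr (fun s hs => by simp [eγ s hs]) (by simp [eγ t ht])).congr_deriv ?_
      simp [γ']; ring
  refine (iInf₂_le_of_le γ γ' (iInf_le _ hγ)).trans_lt ?_
  -- the integrand is continuous, hence bounded on the compact interval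
  let b := Module.finBasis ℝ V
  have hdet : ∀ p : PosForm V, (LinearMap.BilinForm.toMatrix b p.form).det ≠ 0 := fun p =>
    (LinearMap.BilinForm.nondegenerate_iff_det_ne_zero b).1 p.nondegenerate
  have cH : ContinuousOn (fun t => LinearMap.BilinForm.toMatrix b (γ t).form) (Icc 0 1) := by
    have : Continuous fun t : ℝ => (1 - t) • LinearMap.BilinForm.toMatrix b h.form +
        t • LinearMap.BilinForm.toMatrix b k.form := by fun_prop
    exact this.continuousOn.congr fun t ht => by simp [eγ t ht]
  have cHi : ContinuousOn (fun t => (LinearMap.BilinForm.toMatrix b (γ t).form)⁻¹) (Icc 0 1) := by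
    simp only [Matrix.inv_def, Ring.inverse_eq_inv']
    have c1 : ContinuousOn (fun t => (LinearMap.BilinForm.toMatrix b (γ t).form).det)
      (Icc 0 1) := (continuous_id.matrix_det).comp_continuousOn cH
    have c2 : ContinuousOn (fun t => (LinearMap.BilinForm.toMatrix b (γ t).form).adjugate)
      (Icc 0 1) := (continuous_id.matrix_adjugate).comp_continuousOn cH
    exact (c1.inv₀ fun t _ => hdet _).smul c2
  have cI : ContinuousOn (fun t => √(ebinInner g₀ (γ t) (γ' t) (γ' t))) (Icc 0 1) := by
    refine Real.continuous_sqrt.comp_continuousOn ?_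
    have e : ∀ t, ebinInner g₀ (γ t) (γ' t) (γ' t) =
        (((LinearMap.BilinForm.toMatrix b (k.form - h.form) *
            (LinearMap.BilinForm.toMatrix b (γ t).form)⁻¹)ᵀ *
          (LinearMap.BilinForm.toMatrix b (k.form - h.form) *
            (LinearMap.BilinForm.toMatrix b (γ t).form)⁻¹)ᵀ)).trace *
        √(((LinearMap.BilinForm.toMatrix b (γ t).form *
          (LinearMap.BilinForm.toMatrix b g₀.form)⁻¹)ᵀ).det) := fun t => by
      rw [ebinInner, LinearMap.trace_eq_matrix_trace ℝ b, LinearMap.toMatrix_comp b b b,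
        ← LinearMap.det_toMatrix b, toMatrix_invComp, toMatrix_invComp]
    simp only [e]
    have cA : ContinuousOn (fun t => (LinearMap.BilinForm.toMatrix b (k.form - h.form) *
        (LinearMap.BilinForm.toMatrix b (γ t).form)⁻¹)ᵀ) (Icc 0 1) :=
      (continuous_id.matrix_transpose).comp_continuousOn (continuousOn_const.mul cHi)
    have cB : ContinuousOn (fun t => (LinearMap.BilinForm.toMatrix b (γ t).form *
        (LinearMap.BilinForm.toMatrix b g₀.form)⁻¹)ᵀ) (Icc 0 1) :=
      (continuous_id.matrix_transpose).comp_continuousOn (cH.mul continuousOn_const)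
    exact ((continuous_id.matrix_trace).comp_continuousOn (cA.mul cA)).mul
      (Real.continuous_sqrt.comp_continuousOn ((continuous_id.matrix_det).comp_continuousOn cB))
  obtain ⟨C, hC⟩ := isCompact_Icc.bddAbove_image cI
  calc ebinLength g₀ γ γ' ≤ ∫⁻ _ in Icc (0 : ℝ) 1, ENNReal.ofReal C :=
        setLIntegral_mono' measurableSet_Icc fun t ht =>
          ENNReal.ofReal_le_ofReal (hC (mem_image_of_mem _ ht))
    _ < ⊤ := by simp

/-- The space `S²₊ V*`, to be endowed with the Riemannian distance of `ebinInner g₀`. -/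
def Fiber (_g₀ : PosForm V) : Type _ := PosForm V

/-- An element of `S²₊ V*`, seen in the metric space `Fiber g₀`. -/
def Fiber.of (g₀ h : PosForm V) : Fiber g₀ := h

instance (g₀ : PosForm V) : PseudoEMetricSpace (Fiber g₀) where
  edist h k := ebinEDist g₀ h k
  edist_self h := ebinEDist_self g₀ h
  edist_comm h k := le_antisymm (ebinEDist_comm_le g₀ k h) (ebinEDist_comm_le g₀ h k)
  edist_triangle h k l := ebinEDist_triangle g₀ h k l

instance (g₀ : PosForm V) : PseudoMetricSpace (Fiber g₀) :=
  PseudoEMetricSpace.toPseudoMetricSpace fun h k => (ebinEDist_lt_top g₀ h k).ne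

theorem apply_invComp (h : PosForm V) (a : LinearMap.BilinForm ℝ V) (v w : V) :
    h.form (h.invComp a v) w = a v w :=
  LinearMap.BilinForm.apply_toDual_symm_apply (hB := h.nondegenerate) (a v) w

theorem invComp_eq_of (h : PosForm V) (a : LinearMap.BilinForm ℝ V) (f : V →ₗ[ℝ] V)
    (hf : ∀ v w, h.form (f v) w = a v w) : h.invComp a = f := by
  ext v
  refine sub_eq_zero.1 (h.nondegenerate.1 _ fun w => ?_)
  simp [apply_invComp, hf]

theorem det_invComp_pos (g₀ h : PosForm V) : 0 < LinearMap.det (g₀.invComp h.form) := by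
  classical
  let b := Module.finBasis ℝ V
  have hp : ∀ p : PosForm V, 0 < (LinearMap.BilinForm.toMatrix b p.form).det := fun p => by
    refine Matrix.PosDef.det_pos (Matrix.PosDef.of_dotProduct_mulVec_pos ?_ fun x hx => ?_)
    · ext i j
      simp [LinearMap.BilinForm.toMatrix_apply, p.symm]
    · have h0 : b.equivFun.symm x ≠ 0 := b.equivFun.symm.map_ne_zero_iff.2 hx
      have := p.pos _ h0
      rwa [← LinearMap.BilinForm.dotProduct_toMatrix_mulVec b] at this
  rw [← LinearMap.det_toMatrix b, toMatrix_invComp, Matrix.det_transpose, Matrix.det_mul,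
    Matrix.det_nonsing_inv, Ring.inverse_eq_inv']
  exact mul_pos (hp _) (inv_pos.2 (hp _))

variable {W : Type*} [AddCommGroup W] [Module ℝ W] [FiniteDimensional ℝ W]

theorem invComp_push (e : V ≃ₗ[ℝ] W) (h : PosForm V) (a : LinearMap.BilinForm ℝ V) :
    (h.push e).invComp (a.compl₁₂ e.symm.toLinearMap e.symm.toLinearMap) =
      e.toLinearMap ∘ₗ h.invComp a ∘ₗ e.symm.toLinearMap :=
  invComp_eq_of _ _ _ fun v w => by simp [PosForm.push, apply_invComp]

/-- Transport along a linear isomorphism multiplies the scalar products by a constant. -/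
theorem ebinInner_push (e : V ≃ₗ[ℝ] W) (g₀ h : PosForm V) (g₁ : PosForm W)
    (a : LinearMap.BilinForm ℝ V) :
    ebinInner g₁ (h.push e) (a.compl₁₂ e.symm.toLinearMap e.symm.toLinearMap)
      (a.compl₁₂ e.symm.toLinearMap e.symm.toLinearMap) =
      √(LinearMap.det (g₁.invComp (g₀.push e).form)) * ebinInner g₀ h a a := by
  have h1 : g₁.invComp (h.push e).form =
      g₁.invComp (g₀.push e).form ∘ₗ (e.toLinearMap ∘ₗ g₀.invComp h.form ∘ₗ e.symm.toLinearMap) := by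
    refine invComp_eq_of _ _ _ fun v w => ?_
    simp [apply_invComp, PosForm.push]
  have h2 : e.toLinearMap ∘ₗ h.invComp a ∘ₗ e.symm.toLinearMap ∘ₗ
      (e.toLinearMap ∘ₗ h.invComp a ∘ₗ e.symm.toLinearMap) =
      e.conj (h.invComp a ∘ₗ h.invComp a) := by
    ext v; simp [LinearEquiv.conj_apply]
  rw [ebinInner, invComp_push, h1, LinearMap.det_comp, LinearMap.det_conj,
    Real.sqrt_mul (det_invComp_pos _ _).le]
  rw [LinearMap.comp_assoc, LinearMap.comp_assoc, h2, LinearMap.trace_conj', ebinInner]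
  ring

theorem ebinEDist_push_le (e : V ≃ₗ[ℝ] W) (g₀ h k : PosForm V) (g₁ : PosForm W) :
    ebinEDist g₁ (h.push e) (k.push e) ≤
      ENNReal.ofReal (√√(LinearMap.det (g₁.invComp (g₀.push e).form))) * ebinEDist g₀ h k := by
  have hc := Real.sqrt_pos.2 (Real.sqrt_pos.2 (det_invComp_pos g₁ (g₀.push e)))
  have h0 := (ENNReal.ofReal_pos.2 hc).ne'
  rw [← ENNReal.div_le_iff' h0 ENNReal.ofReal_ne_top]
  refine le_iInf₂ fun γ γ' => le_iInf fun hγ => ?_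
  rw [ENNReal.div_le_iff' h0 ENNReal.ofReal_ne_top]
  have hp : IsC1Path (fun t => (γ t).push e)
      (fun t => (γ' t).compl₁₂ e.symm.toLinearMap e.symm.toLinearMap) (h.push e) (k.push e) :=
    ⟨by simp [hγ.source], by simp [hγ.target], fun t ht v w => hγ.hasDeriv t ht _ _,
      fun v w => hγ.cont _ _⟩
  refine (iInf₂_le_of_le _ _ (iInf_le _ hp)).trans ?_
  rw [ebinLength, ebinLength, ← lintegral_const_mul' _ _ ENNReal.ofReal_ne_top]
  refine le_of_eq (lintegral_congr fun t => ?_)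
  rw [ebinInner_push e g₀, Real.sqrt_mul (Real.sqrt_nonneg _),
    ENNReal.ofReal_mul (Real.sqrt_nonneg _)]

/-- The map `S²₊ V* → S²₊ W*` induced by a linear isomorphism `e : V → W`. -/
def Fiber.push {g₀ : PosForm V} {g₁ : PosForm W} (e : V ≃ₗ[ℝ] W) (h : Fiber g₀) : Fiber g₁ :=
  PosForm.push e h

theorem Fiber.uniformContinuous_push {g₀ : PosForm V} {g₁ : PosForm W} (e : V ≃ₗ[ℝ] W) :
    UniformContinuous (Fiber.push e : Fiber g₀ → Fiber g₁) :=
  LipschitzWith.uniformContinuous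
    (K := (√√(LinearMap.det (g₁.invComp (g₀.push e).form))).toNNReal)
    fun h k => ebinEDist_push_le e g₀ h k g₁

end Forms

/-! ### The manifold, its metrics and the completed bundle -/

/-- The standard scalar product of `ℝⁿ`. -/
def euclideanForm (n : ℕ) : PosForm (EuclideanSpace ℝ (Fin n)) where
  form := innerₗ (EuclideanSpace ℝ (Fin n))
  symm v w := real_inner_comm w v
  pos _ hv := real_inner_self_pos.2 hv

/-- The completion `P̄(n)` of the space `P(n)` of positive definite symmetric forms on `ℝⁿ`, with
respect to the distance of `tr (H⁻¹ A H⁻¹ B) * √(det H)`. -/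
abbrev ModelFiber (n : ℕ) : Type := UniformSpace.Completion (Fiber (euclideanForm n))

section Manifold

variable {n : ℕ} {M : Type*} [TopologicalSpace M] [ChartedSpace (EuclideanSpace ℝ (Fin n)) M]

instance (p : M) : FiniteDimensional ℝ (TangentSpace (𝓡 n) p) :=
  inferInstanceAs (FiniteDimensional ℝ (EuclideanSpace ℝ (Fin n)))

variable [IsManifold (𝓡 n) ∞ M]

/-- The set of smooth Riemannian metrics on the `n`-dimensional manifold `M`, i.e. of smooth
sections of the bundle with fibers `S²₊ T_p^* M`. -/
abbrev SmoothMetric (n : ℕ) (M : Type*) [TopologicalSpace M]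
    [ChartedSpace (EuclideanSpace ℝ (Fin n)) M] [IsManifold (𝓡 n) ∞ M] : Type _ :=
  ContMDiffRiemannianMetric (𝓡 n) ∞ (EuclideanSpace ℝ (Fin n))
    (fun p : M => TangentSpace (𝓡 n) p)

/-- The value at `p` of a smooth Riemannian metric, as an element of `S²₊ T_p^* M`. -/
def metricAt (g : SmoothMetric n M) (p : M) : PosForm (TangentSpace (𝓡 n) p) where
  form := LinearMap.mk₂ ℝ (fun v w => g.inner p v w) (by simp) (by simp) (by simp) (by simp)
  symm v w := g.symm p v w
  pos v hv := g.pos p v hv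

/-- The matrix `g (∂ᵢ, ∂ⱼ)` of a metric in the chart around `x`, at the point with
coordinates `u`. -/
def gramMatrix (g : SmoothMetric n M) (x : M) (u : EuclideanSpace ℝ (Fin n)) :
    Matrix (Fin n) (Fin n) ℝ :=
  let frame (i : Fin n) : TangentSpace (𝓡 n) ((extChartAt (𝓡 n) x).symm u) :=
    mfderiv 𝓘(ℝ, EuclideanSpace ℝ (Fin n)) (𝓡 n) (extChartAt (𝓡 n) x).symm u
      (EuclideanSpace.single i (1 : ℝ) : EuclideanSpace ℝ (Fin n))
  Matrix.of fun i j => g.inner _ (frame i) (frame j)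

section Measure

variable [MeasurableSpace M] [BorelSpace M]

/-- The Riemannian volume of `g` on the domain of the chart around `x` (extended by zero): the
image under the inverse chart of the measure `√(det (g (∂ᵢ, ∂ⱼ))) du`. -/
def chartVolume (g : SmoothMetric n M) (x : M) : Measure M :=
  ((volume.restrict (extChartAt (𝓡 n) x).target).withDensity
    fun u => ENNReal.ofReal (√(gramMatrix g x u).det)).map (extChartAt (𝓡 n) x).symm

/-- The Riemannian volume measure `μ_g`. The measures `chartVolume g x` are the restrictions of
`μ_g` to the chart domains; when countably many of these cover `M` (for instance if `M` is compact),
`μ_g` is their supremum in the lattice of measures. -/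
def riemannianVolume (g : SmoothMetric n M) : Measure M := ⨆ x : M, chartVolume g x

end Measure

/-- The fiber `Ē_p`: the completion of `S²₊ T_p^* M` for the Riemannian distance `d_p` defined by
`g₀`. Its distance is the extension of `d_p`. -/
abbrev EBar (g₀ : SmoothMetric n M) (p : M) : Type :=
  UniformSpace.Completion (Fiber (metricAt g₀ p))

/-- The derivative at `p` of the chart around `x`, as an isomorphism from `T_p M` to `ℝⁿ`. -/
def chartFrame (x p : M) (hp : p ∈ (chartAt (EuclideanSpace ℝ (Fin n)) x).source) :
    TangentSpace (𝓡 n) p ≃L[ℝ] EuclideanSpace ℝ (Fin n) :=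
  (trivializationAt (EuclideanSpace ℝ (Fin n)) (TangentSpace (𝓡 n)) x).continuousLinearEquivAt ℝ p
    (by simpa using hp)

/-- The coordinate expression `Ē_p → P̄(n)` in the chart around `x`: the extension to the completions
of the map sending a form `h` on `T_p M` to its expression in the coordinates of the chart. -/
def toModel (g₀ : SmoothMetric n M) (x p : M)
    (hp : p ∈ (chartAt (EuclideanSpace ℝ (Fin n)) x).source) : EBar g₀ p → ModelFiber n :=
  UniformSpace.Completion.map (Fiber.push (chartFrame x p hp).toLinearEquiv)

/-- The total space of the bundle `Ē` with fibers `Ē_p`. -/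
def EBarTotal (g₀ : SmoothMetric n M) : Type _ := Σ p : M, EBar g₀ p

/-- The map `M → Ē` defined by a section. -/
def sectionMap {g₀ : SmoothMetric n M} (σ : ∀ p : M, EBar g₀ p) (p : M) : EBarTotal g₀ := ⟨p, σ p⟩

/-- The topology of the bundle `Ē`: the sets which correspond to a product `W × O` of open sets in
one of the local trivializations `(p, v) ↦ (p, toModel g₀ x p v)` form a basis. -/
instance (g₀ : SmoothMetric n M) : TopologicalSpace (EBarTotal g₀) :=
  TopologicalSpace.generateFrom
    {S | ∃ (x : M) (W : Set M) (O : Set (ModelFiber n)), IsOpen W ∧ IsOpen O ∧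
      S = {v | v.1 ∈ W ∧ ∃ hp : v.1 ∈ (chartAt (EuclideanSpace ℝ (Fin n)) x).source,
        toModel g₀ x v.1 hp v.2 ∈ O}}

instance (g₀ : SmoothMetric n M) : MeasurableSpace (EBarTotal g₀) := borel _

/-- A smooth Riemannian metric as a section of `Ē`. -/
def toSection (g₀ g : SmoothMetric n M) (p : M) : EBar g₀ p :=
  (Fiber.of (metricAt g₀ p) (metricAt g p) : EBar g₀ p)

variable [MeasurableSpace M] [BorelSpace M]

/-- Square integrable sections of `Ē`: Borel measurable sections `σ` such that
`∫ d_p (σ p, g₀ p) ^ 2 dμ_{g₀} < ∞`. -/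
structure IsL2Section (g₀ : SmoothMetric n M) (σ : ∀ p : M, EBar g₀ p) : Prop where
  measurable : Measurable (sectionMap σ)
  lintegral_lt_top : ∫⁻ p, edist (σ p) (toSection g₀ g₀ p) ^ 2 ∂(riemannianVolume g₀) < ⊤

/-- Equality almost everywhere of square integrable sections. -/
instance l2Setoid (g₀ : SmoothMetric n M) :
    Setoid {σ : ∀ p : M, EBar g₀ p // IsL2Section g₀ σ} where
  r σ τ := ∀ᵐ p ∂(riemannianVolume g₀), σ.1 p = τ.1 p
  iseqv :=
    ⟨fun _ => Filter.Eventually.of_forall fun _ => rfl, fun h => h.mono fun _ hp => hp.symm,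
      fun h h' => by filter_upwards [h, h'] with p hp hp' using hp.trans hp'⟩

/-- The space of square integrable sections of `Ē` up to equality almost everywhere. -/
def EBarL2 (g₀ : SmoothMetric n M) : Type _ := Quotient (l2Setoid g₀)

/-- The class of a square integrable section. -/
def EBarL2.mk {g₀ : SmoothMetric n M} (σ : ∀ p : M, EBar g₀ p) (hσ : IsL2Section g₀ σ) :
    EBarL2 g₀ :=
  Quotient.mk (l2Setoid g₀) ⟨σ, hσ⟩

/-- The distance `d_{L²} (σ, τ) = (∫ d_p (σ p, τ p) ^ 2 dμ_{g₀}) ^ (1 / 2)`, with values in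
`[0, ∞]`. -/
def EBarL2.d {g₀ : SmoothMetric n M} : EBarL2 g₀ → EBarL2 g₀ → ℝ≥0∞ :=
  Quotient.lift₂
    (fun σ τ => (∫⁻ p, edist (σ.1 p) (τ.1 p) ^ 2 ∂(riemannianVolume g₀)) ^ (1 / 2 : ℝ))
    (by
      intro σ τ σ' τ' hσ hτ
      have hσ' : ∀ᵐ p ∂(riemannianVolume g₀), σ.1 p = σ'.1 p := hσ
      have hτ' : ∀ᵐ p ∂(riemannianVolume g₀), τ.1 p = τ'.1 p := hτ
      congr 1
      refine lintegral_congr_ae ?_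
      filter_upwards [hσ', hτ'] with p h1 h2
      rw [h1, h2])

end Manifold

end EbinL2

end

set_option maxSynthPendingDepth 3

noncomputable section

namespace EbinL2

/-! ### Continuity and separability of the distance on positive definite forms. -/

section FormEstimates

variable {V : Type*} [AddCommGroup V] [Module ℝ V]

/-! The scheme is the density of continuous functions in $L^2$: approximate by a piecewise simple
object, shrink the pieces to compact sets, interpolate. Since $\bar E_p$ has no linear structure,
the interpolation takes place in the convex cone of positive definite forms, before completion.

A smooth metric is a continuous section of $\bar E$, hence Borel. By compactness its distance to
$g_0$ is bounded, and the total mass is finite, so it is square integrable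
(`isL2Section_toSection`).

For density, fix a section $\sigma$ and $r>0$. Forms are dense in the separable space $\bar P(n)$,
the inverse chart maps $\bar P(n)\to\bar E_p$ are Lipschitz with constants bounded on compact
subsets of a chart, and a form that is constant in a chart near a compact set extends to a global
smooth metric. So countably many measurable sets cover $M$, on each of which $\sigma$ is within $r$
of a smooth metric (`exists_cover_edist_toSection_le`). Finitely many of them suffice up to small
measure; on the remainder $g_0$ is used.

Inner regularity replaces the resulting disjoint pieces by compact ones, losing a set $R$ of small
measure. A partition of unity then gives one smooth metric $g$ that equals the chosen metric on each
compact piece and is everywhere a pointwise convex combination of the chosen ones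
(`exists_smoothMetric_eq_compl`). All these convex combinations lie within a distance $D$ of $g_0$,
with $D$ depending only on the finite family (`exists_edist_convexMetric_le`), so $\mu(R)$ can be
made small after $D$ is known. The error is then at most $r^2$ from the good part, a multiple of
$D^2\mu(R)$, and a multiple of the integral of $d_p(\sigma,g_0)^2$ over a set of small measure,
which is small by absolute continuity of the integral. -/

theorem PosForm.ext_form {p q : PosForm V} (h : p.form = q.form) : p = q := by
  cases p; cases q; simpa using h

/-- The point at time `t` of the segment from `h` to `k`. -/
def PosForm.segment (h k : PosForm V) (t : ℝ) (ht : t ∈ Icc (0 : ℝ) 1) : PosForm V where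
  form := h.form + t • (k.form - h.form)
  symm v w := by simp [h.symm v w, k.symm v w]
  pos v hv := by
    have h1 := h.pos v hv
    have h2 := k.pos v hv
    simp only [LinearMap.add_apply, LinearMap.smul_apply, LinearMap.sub_apply, smul_eq_mul]
    rcases ht.1.eq_or_lt with rfl | h0
    · simpa using h1
    · nlinarith [mul_pos h0 h2, mul_nonneg (sub_nonneg.2 ht.2) h1.le]

/-- The matrix expression of `ebinInner`. -/
def ebinMatrix {ι : Type*} [Fintype ι] [DecidableEq ι] (G H A : Matrix ι ι ℝ) : ℝ :=
  ((A * H⁻¹)ᵀ * (A * H⁻¹)ᵀ).trace * √((H * G⁻¹)ᵀ.det)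

/-- The inverse is the adjugate divided by the determinant, so the expression is continuous wherever
`H` is invertible. -/
theorem continuousAt_ebinMatrix {ι X : Type*} [Fintype ι] [DecidableEq ι] [TopologicalSpace X]
    (G : Matrix ι ι ℝ) {H A : X → Matrix ι ι ℝ} {x : X} (hH : ContinuousAt H x)
    (hA : ContinuousAt A x) (hdet : (H x).det ≠ 0) :
    ContinuousAt (fun y => ebinMatrix G (H y) (A y)) x := by
  have cHi : ContinuousAt (fun y => (H y)⁻¹) x := by
    simp only [Matrix.inv_def, Ring.inverse_eq_inv']
    exact (((continuous_id.matrix_det).continuousAt.comp hH).inv₀ hdet).smul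
      ((continuous_id.matrix_adjugate).continuousAt.comp hH)
  have cA : ContinuousAt (fun y => (A y * (H y)⁻¹)ᵀ) x :=
    (continuous_id.matrix_transpose).continuousAt.comp (hA.mul cHi)
  have cB : ContinuousAt (fun y => (H y * G⁻¹)ᵀ) x :=
    (continuous_id.matrix_transpose).continuousAt.comp (hH.mul continuousAt_const)
  exact ((continuous_id.matrix_trace).continuousAt.comp (cA.mul cA)).mul
    (Real.continuous_sqrt.continuousAt.comp ((continuous_id.matrix_det).continuousAt.comp cB))

variable {ι : Type*} [Fintype ι] [DecidableEq ι]

theorem PosForm.det_toMatrix_ne_zero (b : Module.Basis ι ℝ V) (h : PosForm V) :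
    (LinearMap.BilinForm.toMatrix b h.form).det ≠ 0 :=
  (LinearMap.BilinForm.nondegenerate_iff_det_ne_zero b).1 h.nondegenerate

variable [FiniteDimensional ℝ V]

theorem ebinInner_eq_ebinMatrix (b : Module.Basis ι ℝ V) (g₀ h : PosForm V)
    (a : LinearMap.BilinForm ℝ V) :
    ebinInner g₀ h a a = ebinMatrix (LinearMap.BilinForm.toMatrix b g₀.form)
      (LinearMap.BilinForm.toMatrix b h.form) (LinearMap.BilinForm.toMatrix b a) := by
  rw [ebinInner, LinearMap.trace_eq_matrix_trace ℝ b, LinearMap.toMatrix_comp b b b,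
    ← LinearMap.det_toMatrix b, toMatrix_invComp, toMatrix_invComp, ebinMatrix]

/-- The distance of `h` and `k` is at most the length of the segment between them. -/
theorem ebinEDist_le_of_segment (g₀ h k : PosForm V) (C : ℝ)
    (hC : ∀ t (ht : t ∈ Icc (0 : ℝ) 1),
      √(ebinInner g₀ (h.segment k t ht) (k.form - h.form) (k.form - h.form)) ≤ C) :
    ebinEDist g₀ h k ≤ ENNReal.ofReal C := by
  classical
  let γ : ℝ → PosForm V := fun t => if ht : t ∈ Icc (0 : ℝ) 1 then h.segment k t ht else h
  let γ' : ℝ → LinearMap.BilinForm ℝ V := fun _ => k.form - h.form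
  have eγ : ∀ t (ht : t ∈ Icc (0 : ℝ) 1), γ t = h.segment k t ht := fun t ht => dif_pos ht
  have hγ : IsC1Path γ γ' h k := by
    refine ⟨PosForm.ext_form ?_, PosForm.ext_form ?_, fun t ht v w => ?_,
      fun v w => continuousOn_const⟩
    · rw [eγ 0 (by simp)]; simp [PosForm.segment]
    · rw [eγ 1 (by simp)]; ext v w; simp [PosForm.segment]
    · have : HasDerivWithinAt (fun s : ℝ => h.form v w + s * (k.form v w - h.form v w))
          (1 * (k.form v w - h.form v w)) (Icc 0 1) t :=
        ((hasDerivWithinAt_id t _).mul_const _).const_add _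
      refine (this.congr (fun s hs => by simp [eγ s hs, PosForm.segment])
        (by simp [eγ t ht, PosForm.segment])).congr_deriv ?_
      simp [γ']
  refine (iInf₂_le_of_le γ γ' (iInf_le _ hγ)).trans ?_
  calc ebinLength g₀ γ γ' ≤ ∫⁻ _ in Icc (0 : ℝ) 1, ENNReal.ofReal C :=
        setLIntegral_mono' measurableSet_Icc fun t ht =>
          ENNReal.ofReal_le_ofReal (by rw [eγ t ht]; exact hC t ht)
    _ = ENNReal.ofReal C := by simp

/-- The distance is continuous for the topology of pointwise convergence of forms. -/
theorem tendsto_ebinEDist (g₀ : PosForm V) {X : Type*} {l : Filter X} {H : X → PosForm V}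
    {h : PosForm V} (hH : ∀ v w, Filter.Tendsto (fun x => (H x).form v w) l (𝓝 (h.form v w))) :
    Filter.Tendsto (fun x => ebinEDist g₀ h (H x)) l (𝓝 0) := by
  let b := Module.finBasis ℝ V
  let B := LinearMap.BilinForm.toMatrix b
  have hA : Filter.Tendsto (fun x => B ((H x).form - h.form)) l (𝓝 0) := by
    refine tendsto_pi_nhds.2 fun i => tendsto_pi_nhds.2 fun j => ?_
    simpa [B, LinearMap.BilinForm.toMatrix_apply] using
      (hH (b i) (b j)).sub_const (h.form (b i) (b j))
  -- Along the segment the velocity is the constant `A = H x - h`. The speed is jointly continuous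
  -- in `(A, t)` and vanishes at `A = 0`, so compactness of `[0, 1]` makes it small uniformly in
  -- `t`.
  have hF : ∀ t : ℝ, ContinuousAt (fun z : Matrix _ _ ℝ × ℝ =>
      √(ebinMatrix (B g₀.form) (B h.form + z.2 • z.1) z.1)) (0, t) := fun t =>
    Real.continuous_sqrt.continuousAt.comp <| continuousAt_ebinMatrix _ (by fun_prop) (by fun_prop)
      (by simpa [B] using h.det_toMatrix_ne_zero b)
  rw [ENNReal.tendsto_nhds_zero]
  intro ε hε
  obtain ⟨C, hC0, hCε⟩ : ∃ C : ℝ, 0 < C ∧ ENNReal.ofReal C ≤ ε := by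
    obtain ⟨c, hc0, hc⟩ := ENNReal.lt_iff_exists_real_btwn.1 hε
    exact ⟨c, ENNReal.ofReal_pos.1 hc.1, hc.2.le⟩
  have key : ∀ᶠ A : Matrix _ _ ℝ in 𝓝 0, ∀ t ∈ Icc (0 : ℝ) 1,
      √(ebinMatrix (B g₀.form) (B h.form + t • A) A) < C := by
    refine isCompact_Icc.eventually_forall_of_forall_eventually fun t _ => ?_
    exact (hF t).eventually_lt_const (by simpa [ebinMatrix] using hC0)
  filter_upwards [hA.eventually key] with x hx
  refine (ebinEDist_le_of_segment g₀ h (H x) C fun t ht => ?_).trans hCε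
  rw [ebinInner_eq_ebinMatrix b]
  refine (le_of_eq ?_).trans (hx t ht).le
  simp [PosForm.segment, B]

theorem tendsto_fiber {g₀ : PosForm V} {X : Type*} {l : Filter X} {H : X → PosForm V}
    {h : PosForm V} (hH : ∀ v w, Filter.Tendsto (fun x => (H x).form v w) l (𝓝 (h.form v w))) :
    Filter.Tendsto (fun x => Fiber.of g₀ (H x)) l (𝓝 (Fiber.of g₀ h)) := by
  rw [tendsto_iff_edist_tendsto_0]
  refine (tendsto_ebinEDist g₀ hH).congr fun x => ?_
  exact edist_comm (Fiber.of g₀ h) (Fiber.of g₀ (H x))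

theorem continuous_fiber {g₀ : PosForm V} {X : Type*} [TopologicalSpace X] {H : X → PosForm V}
    (hH : ∀ v w, Continuous fun x => (H x).form v w) :
    Continuous fun x => Fiber.of g₀ (H x) :=
  continuous_iff_continuousAt.2 fun _ => tendsto_fiber fun v w => (hH v w).continuousAt

omit [DecidableEq ι] in
/-- Convergence of the Gram matrices in a basis implies pointwise convergence of the forms. -/
theorem continuous_fiber_of_basis {g₀ : PosForm V} {X : Type*} [TopologicalSpace X]
    {H : X → PosForm V} (b : Module.Basis ι ℝ V)
    (hH : ∀ i j, Continuous fun x => (H x).form (b i) (b j)) :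
    Continuous fun x => Fiber.of g₀ (H x) := by
  refine continuous_fiber fun v w => ?_
  have : ∀ x, (H x).form v w =
      ∑ i, ∑ j, b.repr v i * (b.repr w j * (H x).form (b i) (b j)) := fun x => by
    conv_lhs => rw [← b.sum_repr v, ← b.sum_repr w]
    simp only [map_sum, LinearMap.sum_apply, map_smul, LinearMap.smul_apply, smul_eq_mul,
      Finset.mul_sum]
    rw [Finset.sum_comm]
    refine Finset.sum_congr rfl fun i _ => Finset.sum_congr rfl fun j _ => ?_
    ring
  simp only [this]
  fun_prop

/-- The topology of Gram coefficients is second countable and maps continuously onto `Fiber g₀`.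
This supplies the dense sequence of forms used to approximate sections. -/
instance separableSpace_fiber (g₀ : PosForm V) : TopologicalSpace.SeparableSpace (Fiber g₀) := by
  let b := Module.finBasis ℝ V
  let f : PosForm V → Fin (Module.finrank ℝ V) → Fin (Module.finrank ℝ V) → ℝ :=
    fun h i j => h.form (b i) (b j)
  let _ : TopologicalSpace (PosForm V) := TopologicalSpace.induced f inferInstance
  have hf : Topology.IsInducing f := ⟨rfl⟩
  have : SecondCountableTopology (PosForm V) := hf.secondCountableTopology
  have hc : Continuous (fun h : PosForm V => Fiber.of g₀ h) := by
    refine continuous_fiber_of_basis b fun i j => ?_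
    exact (continuous_apply_apply i j).comp hf.continuous
  have hs : Function.Surjective (fun h : PosForm V => Fiber.of g₀ h) := fun h => ⟨h, rfl⟩
  exact hs.denseRange.separableSpace hc

/-- Expresses the scaling factor of a chart as a quotient of Gram determinants in which only the
denominator depends on `g₀`. -/
theorem det_invComp_push_symm {W : Type*} [AddCommGroup W] [Module ℝ W] [FiniteDimensional ℝ W]
    (b : Module.Basis ι ℝ W) (e : V ≃ₗ[ℝ] W) (g₀ : PosForm V) (h : PosForm W) :
    LinearMap.det (g₀.invComp (h.push e.symm).form) =
      (LinearMap.BilinForm.toMatrix b h.form).det *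
        (Matrix.of fun i j => g₀.form (e.symm (b i)) (e.symm (b j))).det⁻¹ := by
  rw [← LinearMap.det_toMatrix (b.map e.symm), toMatrix_invComp, Matrix.det_transpose,
    Matrix.det_mul, Matrix.det_nonsing_inv, Ring.inverse_eq_inv']
  congr 3
  · ext i j
    simp [LinearMap.BilinForm.toMatrix_apply, PosForm.push]
  · ext i j
    simp [LinearMap.BilinForm.toMatrix_apply]

end FormEstimates

/-! ### Smooth metrics in charts, and existence from local data. -/

section SmoothMetrics

variable {n : ℕ} {M : Type*} [TopologicalSpace M] [ChartedSpace (EuclideanSpace ℝ (Fin n)) M]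
  [IsManifold (𝓡 n) ∞ M]

/-- The fibers of the bundle of bilinear forms on the tangent spaces. -/
abbrev BilinFiber (n : ℕ) {M : Type*} [TopologicalSpace M]
    [ChartedSpace (EuclideanSpace ℝ (Fin n)) M] (p : M) : Type _ :=
  TangentSpace (𝓡 n) p →L[ℝ] TangentSpace (𝓡 n) p →L[ℝ] ℝ

/-- The model fiber of the bundle of bilinear forms on the tangent spaces. -/
abbrev BilinModel (n : ℕ) : Type :=
  EuclideanSpace ℝ (Fin n) →L[ℝ] EuclideanSpace ℝ (Fin n) →L[ℝ] ℝ

/-- The coordinate expression of a bilinear form in the chart around `c`. -/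
theorem trivializationAt_bilin_apply (c p : M) (hp : p ∈ (chartAt (EuclideanSpace ℝ (Fin n)) c).source)
    (φ : BilinFiber n p) (v w : EuclideanSpace ℝ (Fin n)) :
    (trivializationAt (BilinModel n) (BilinFiber n (M := M)) c ⟨p, φ⟩).2 v w =
      φ ((chartFrame c p hp).symm v) ((chartFrame c p hp).symm w) := by
  have hb : p ∈ (trivializationAt (EuclideanSpace ℝ (Fin n) →L[ℝ] ℝ)
    (fun x : M => TangentSpace (𝓡 n) x →L[ℝ] ℝ) c).baseSet := by
    rw [hom_trivializationAt_baseSet]; exact ⟨by simpa using hp, by simp⟩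
  rw [hom_trivializationAt_apply]
  simp only [ContinuousLinearMap.inCoordinates, ContinuousLinearMap.comp_apply,
    Trivialization.continuousLinearMapAt_apply]
  rw [Trivialization.coe_linearMapAt_of_mem _ hb]
  beta_reduce
  rw [hom_trivializationAt_apply]
  have hs : ∀ u, Trivialization.symmL ℝ
      (trivializationAt (EuclideanSpace ℝ (Fin n)) (TangentSpace (𝓡 n)) c) p u =
      (chartFrame c p hp).symm u := fun u => congrFun
        (Trivialization.symm_continuousLinearEquivAt_eq _ (by simpa using hp)).symm u
  simp [ContinuousLinearMap.inCoordinates, hs]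

/-- The form `H` on `ℝⁿ`, transported to the tangent spaces by the chart around `c`
(extended by zero outside the domain of the chart). -/
def chartPull (c : M) (H : PosForm (EuclideanSpace ℝ (Fin n))) (p : M) : BilinFiber n p :=
  open Classical in
  if hp : p ∈ (chartAt (EuclideanSpace ℝ (Fin n)) c).source then
    ((chartFrame c p hp).arrowCongr
      ((chartFrame c p hp).arrowCongr (ContinuousLinearEquiv.refl ℝ ℝ))).symm
        (LinearMap.toContinuousBilinearMap H.form)
  else 0

theorem chartPull_apply (c : M) (H : PosForm (EuclideanSpace ℝ (Fin n))) {p : M}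
    (hp : p ∈ (chartAt (EuclideanSpace ℝ (Fin n)) c).source) (v w : TangentSpace (𝓡 n) p) :
    chartPull c H p v w = (H.push (chartFrame c p hp).toLinearEquiv.symm).form v w := by
  simp [chartPull, hp, PosForm.push]

theorem contMDiffOn_section_iff_coord (c : M) (φ : ∀ p : M, BilinFiber n p) :
    ContMDiffOn (𝓡 n) ((𝓡 n).prod 𝓘(ℝ, BilinModel n)) ∞
      (fun p => TotalSpace.mk' (BilinModel n) p (φ p))
      (chartAt (EuclideanSpace ℝ (Fin n)) c).source ↔
    ContMDiffOn (𝓡 n) 𝓘(ℝ, BilinModel n) ∞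
      (fun p => (trivializationAt (BilinModel n) (BilinFiber n (M := M)) c ⟨p, φ p⟩).2)
      (chartAt (EuclideanSpace ℝ (Fin n)) c).source := by
  refine Trivialization.contMDiffOn_section_iff _ (chartAt _ c).open_source fun p hp => ?_
  simpa using hp

/-- In its own chart the transported form has constant coefficients. -/
theorem contMDiffOn_chartPull (c : M) (H : PosForm (EuclideanSpace ℝ (Fin n))) :
    ContMDiffOn (𝓡 n) ((𝓡 n).prod 𝓘(ℝ, BilinModel n)) ∞
      (fun p => TotalSpace.mk' (BilinModel n) p (chartPull c H p))
      (chartAt (EuclideanSpace ℝ (Fin n)) c).source := by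
  rw [contMDiffOn_section_iff_coord]
  refine (contMDiffOn_const (c := LinearMap.toContinuousBilinearMap H.form)).congr fun p hp => ?_
  ext v w
  rw [trivializationAt_bilin_apply c p hp, chartPull_apply c H hp]
  simp [PosForm.push]

/-- The coefficients of a smooth metric in a chart are continuous. -/
theorem continuous_metricAt_coord (g : SmoothMetric n M) (c : M) (v w : EuclideanSpace ℝ (Fin n)) :
    Continuous fun p : (chartAt (EuclideanSpace ℝ (Fin n)) c).source =>
      (metricAt g p).form ((chartFrame c p p.2).symm v) ((chartFrame c p p.2).symm w) := by
  have h := (contMDiffOn_section_iff_coord c g.inner).1 g.contMDiff.contMDiffOn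
  have h1 := continuousOn_iff_continuous_domRestrict.1 h.continuousOn
  refine ((h1.clm_apply (continuous_const (y := v))).clm_apply
    (continuous_const (y := w))).congr fun p => ?_
  exact trivializationAt_bilin_apply c p p.2 _ v w

/-- By homogeneity `φ v v ≥ m * ‖v‖ ^ 2`, where `m > 0` is the minimum of `φ` on the unit sphere.
Boundedness of the unit ball is part of the structure `ContMDiffRiemannianMetric`. -/
theorem isVonNBounded_of_pos {E : Type*} [NormedAddCommGroup E] [NormedSpace ℝ E]
    [FiniteDimensional ℝ E] (φ : E →L[ℝ] E →L[ℝ] ℝ) (hφ : ∀ v, v ≠ 0 → 0 < φ v v) :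
    Bornology.IsVonNBounded ℝ {v : E | φ v v < 1} := by
  rw [NormedSpace.isVonNBounded_iff]
  have : ProperSpace E := FiniteDimensional.proper ℝ E
  -- The sphere is empty exactly when `E` is trivial, which happens in dimension `0`.
  rcases (Metric.sphere (0 : E) 1).eq_empty_or_nonempty with he | hne
  · have : Subsingleton E := by
      by_contra hs
      rw [not_subsingleton_iff_nontrivial] at hs
      exact (NormedSpace.sphere_nonempty (x := (0 : E)) (r := 1)).2 zero_le_one |>.ne_empty he
    exact Set.Finite.isBounded (Set.toFinite _)
  obtain ⟨u, hu, hmin⟩ := (isCompact_sphere (0 : E) 1).exists_isMinOn hne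
    (f := fun v => φ v v) (by fun_prop)
  have hu0 : 0 < φ u u := hφ u (by rintro rfl; simp at hu)
  refine isBounded_iff_forall_norm_le.2 ⟨√(1 / φ u u), fun v hv => Real.le_sqrt_of_sq_le ?_⟩
  rw [le_div_iff₀ hu0]
  rcases eq_or_ne v 0 with rfl | hv0
  · simp
  have hn : ‖v‖ ≠ 0 := norm_ne_zero_iff.2 hv0
  have h1 := hmin (show ‖v‖⁻¹ • v ∈ Metric.sphere (0 : E) 1 by simp [norm_smul, hn])
  replace h1 : φ u u ≤ φ (‖v‖⁻¹ • v) (‖v‖⁻¹ • v) := h1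
  simp only [map_smul, smul_apply, smul_eq_mul] at h1
  have hv1 : φ v v < 1 := hv
  calc ‖v‖ ^ 2 * φ u u ≤ ‖v‖ ^ 2 * (‖v‖⁻¹ * (‖v‖⁻¹ * φ v v)) := by gcongr
    _ = φ v v := by field_simp
    _ ≤ 1 := hv1.le

variable [T2Space M] [CompactSpace M]

/-- Smooth metrics with values in given convex sets of forms exist if they exist locally. -/
theorem exists_smoothMetric_mem (t : ∀ p : M, Set (BilinFiber n p)) (ht : ∀ p, Convex ℝ (t p))
    (hsymm : ∀ p, ∀ φ ∈ t p, ∀ v w, φ v w = φ w v)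
    (hpos : ∀ p, ∀ φ ∈ t p, ∀ v, v ≠ 0 → 0 < φ v v)
    (hloc : ∀ p₀ : M, ∃ U ∈ 𝓝 p₀, ∃ s : ∀ p : M, BilinFiber n p,
      ContMDiffOn (𝓡 n) ((𝓡 n).prod 𝓘(ℝ, BilinModel n)) ∞
        (fun p => TotalSpace.mk' (BilinModel n) p (s p)) U ∧ ∀ p ∈ U, s p ∈ t p) :
    ∃ g : SmoothMetric n M, ∀ p, g.inner p ∈ t p := by
  -- The local sections are averaged with a smooth partition of unity; convexity of `t p` keeps the
  -- average inside.
  obtain ⟨s, hs⟩ := exists_contMDiffSection_forall_mem_convex_of_local (𝓡 n) (n := ⊤)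
    (F_fiber := BilinModel n) (BilinFiber n (M := M)) t ht hloc
  refine ⟨⟨s, fun p => hsymm p _ (hs p), fun p => hpos p _ (hs p), fun p => ?_, s.contMDiff⟩, hs⟩
  exact isVonNBounded_of_pos (E := EuclideanSpace ℝ (Fin n)) (s p) (hpos p _ (hs p))

end SmoothMetrics

/-! ### Lipschitz control by charts; smooth metrics as bounded continuous sections. -/

section Sections

variable {n : ℕ} {M : Type*} [TopologicalSpace M] [ChartedSpace (EuclideanSpace ℝ (Fin n)) M]
  [IsManifold (𝓡 n) ∞ M]

theorem PosForm.push_push_symm {V W : Type*} [AddCommGroup V] [Module ℝ V] [AddCommGroup W]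
    [Module ℝ W] (e : V ≃ₗ[ℝ] W) (h : PosForm V) : (h.push e).push e.symm = h :=
  PosForm.ext_form (by ext v w; simp [PosForm.push])

/-- A Lipschitz constant of the inverse of the chart around `c`, from `P(n)` to `E_p`. -/
def chartLipschitz (g₀ : SmoothMetric n M) (c : M)
    (p : (chartAt (EuclideanSpace ℝ (Fin n)) c).source) : NNReal :=
  (√√(LinearMap.det ((metricAt g₀ p.1).invComp
    ((euclideanForm n).push (chartFrame c p.1 p.2).toLinearEquiv.symm).form))).toNNReal

/-- Transport multiplies the scalar products by the root of a determinant, hence lengths by its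
fourth root. -/
theorem lipschitzWith_push_symm (g₀ : SmoothMetric n M) (c : M)
    (p : (chartAt (EuclideanSpace ℝ (Fin n)) c).source) :
    LipschitzWith (chartLipschitz g₀ c p)
      (Fiber.push (chartFrame c p.1 p.2).toLinearEquiv.symm :
        Fiber (euclideanForm n) → Fiber (metricAt g₀ p.1)) :=
  fun h k => ebinEDist_push_le (chartFrame c p.1 p.2).toLinearEquiv.symm (euclideanForm n) h k
    (metricAt g₀ p.1)

theorem continuous_chartLipschitz (g₀ : SmoothMetric n M) (c : M) :
    Continuous (chartLipschitz g₀ c) := by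
  let b := (EuclideanSpace.basisFun (Fin n) ℝ).toBasis
  have hg : Continuous fun p : (chartAt (EuclideanSpace ℝ (Fin n)) c).source =>
      Matrix.of fun i j => (metricAt g₀ p.1).form
        ((chartFrame c p.1 p.2).toLinearEquiv.symm (b i))
        ((chartFrame c p.1 p.2).toLinearEquiv.symm (b j)) :=
    continuous_matrix fun i j => continuous_metricAt_coord g₀ c (b i) (b j)
  -- This is the Gram determinant of `g₀` in the basis of `T_p M` transported from `ℝⁿ`.
  have hne (p : (chartAt (EuclideanSpace ℝ (Fin n)) c).source) :
      (Matrix.of fun i j => (metricAt g₀ p.1).form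
        ((chartFrame c p.1 p.2).toLinearEquiv.symm (b i))
        ((chartFrame c p.1 p.2).toLinearEquiv.symm (b j))).det ≠ 0 := by
    convert PosForm.det_toMatrix_ne_zero (b.map (chartFrame c p.1 p.2).toLinearEquiv.symm)
      (metricAt g₀ p.1) using 2
    ext i j
    simp [LinearMap.BilinForm.toMatrix_apply]
  unfold chartLipschitz
  simp only [det_invComp_push_symm b]
  exact continuous_real_toNNReal.comp (Real.continuous_sqrt.comp (Real.continuous_sqrt.comp
    (continuous_const.mul ((continuous_id.matrix_det.comp hg).inv₀ hne))))

theorem toModel_coe (g₀ : SmoothMetric n M) (c p : M)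
    (hp : p ∈ (chartAt (EuclideanSpace ℝ (Fin n)) c).source) (h : PosForm (TangentSpace (𝓡 n) p)) :
    toModel g₀ c p hp (Fiber.of (metricAt g₀ p) h : EBar g₀ p) =
      (Fiber.of (euclideanForm n) (h.push (chartFrame c p hp).toLinearEquiv) : ModelFiber n) :=
  UniformSpace.Completion.map_coe (Fiber.uniformContinuous_push _) _

/-- Distances in `Ē_p` are controlled by distances in the coordinates of a chart. -/
theorem edist_le_toModel (g₀ : SmoothMetric n M) (c : M)
    (p : (chartAt (EuclideanSpace ℝ (Fin n)) c).source) (u v : EBar g₀ p.1) :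
    edist u v ≤ chartLipschitz g₀ c p *
      edist (toModel g₀ c p.1 p.2 u) (toModel g₀ c p.1 p.2 v) := by
  -- The two transports are mutually inverse on forms, and passing to completions is functorial for
  -- uniformly continuous maps.
  have hinv (u : EBar g₀ p.1) : UniformSpace.Completion.map
      (Fiber.push (chartFrame c p.1 p.2).toLinearEquiv.symm :
        Fiber (euclideanForm n) → Fiber (metricAt g₀ p.1)) (toModel g₀ c p.1 p.2 u) = u := by
    rw [toModel, ← Function.comp_apply (f := UniformSpace.Completion.map _),
      UniformSpace.Completion.map_comp (Fiber.uniformContinuous_push _)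
        (Fiber.uniformContinuous_push _)]
    have hid : (Fiber.push (chartFrame c p.1 p.2).toLinearEquiv.symm :
        Fiber (euclideanForm n) → Fiber (metricAt g₀ p.1)) ∘
        (Fiber.push (chartFrame c p.1 p.2).toLinearEquiv) = id :=
      funext fun h => PosForm.push_push_symm _ h
    rw [hid, UniformSpace.Completion.map_id, id]
  have := (lipschitzWith_push_symm g₀ c p).completion_map (toModel g₀ c p.1 p.2 u)
    (toModel g₀ c p.1 p.2 v)
  rwa [hinv, hinv] at this

theorem continuous_push_metricAt (g : SmoothMetric n M) (c : M) :
    Continuous fun p : (chartAt (EuclideanSpace ℝ (Fin n)) c).source =>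
      Fiber.of (euclideanForm n)
        ((metricAt g p.1).push (chartFrame c p.1 p.2).toLinearEquiv) :=
  continuous_fiber fun v w => continuous_metricAt_coord g c v w

/-- A smooth metric is a continuous section of `Ē`. -/
theorem continuous_toSection (g₀ g : SmoothMetric n M) :
    Continuous (sectionMap (toSection g₀ g)) := by
  refine continuous_generateFrom_iff.2 ?_
  rintro _ ⟨c, W, O, hW, hO, rfl⟩
  have hc := (continuous_push_metricAt g c)
  have h1 := (hO.preimage ((UniformSpace.Completion.continuous_coe _).comp hc))
  have h2 := (chartAt (EuclideanSpace ℝ (Fin n)) c).open_source.isOpenMap_subtype_val _ h1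
  -- The preimage of a basic open set is `W` intersected with the points of the chart domain whose
  -- coordinate expression lies in `O`.
  convert hW.inter h2 using 1
  ext p
  simp only [mem_preimage, mem_inter_iff, mem_image, Subtype.exists, exists_and_right,
    exists_eq_right]
  refine and_congr Iff.rfl (exists_congr fun hp => ?_)
  exact Eq.to_iff (congrArg (· ∈ O) (toModel_coe g₀ c p hp (metricAt g p)))

/-- Pointwise convex combinations of smooth metrics. -/
def convexMetric {ι : Type*} [Fintype ι] (τ : ι → SmoothMetric n M) (w : stdSimplex ℝ ι) (p : M) :
    PosForm (TangentSpace (𝓡 n) p) where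
  form := ∑ i, w.1 i • (metricAt (τ i) p).form
  symm u v := by simp [(metricAt (τ _) p).symm u v]
  pos v hv := by
    simp only [LinearMap.sum_apply, LinearMap.smul_apply, smul_eq_mul]
    have h0 (i : ι) : 0 ≤ w.1 i * (metricAt (τ i) p).form v v :=
      mul_nonneg (w.2.1 i) ((metricAt (τ i) p).pos v hv).le
    obtain ⟨i, -, hi⟩ : ∃ i ∈ Finset.univ, 0 < w.1 i := by
      refine Finset.exists_lt_of_sum_lt (f := fun _ => (0 : ℝ)) ?_
      simp [w.2.2]
    exact Finset.sum_pos' (fun i _ => h0 i) ⟨i, Finset.mem_univ i,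
      mul_pos hi ((metricAt (τ i) p).pos v hv)⟩

theorem continuous_push_convexMetric {ι : Type*} [Fintype ι] (τ : ι → SmoothMetric n M) (c : M) :
    Continuous fun z : (chartAt (EuclideanSpace ℝ (Fin n)) c).source × stdSimplex ℝ ι =>
      Fiber.of (euclideanForm n)
        ((convexMetric τ z.2 z.1.1).push (chartFrame c z.1.1 z.1.2).toLinearEquiv) := by
  refine continuous_fiber fun v w => ?_
  have : Continuous fun z : (chartAt (EuclideanSpace ℝ (Fin n)) c).source × stdSimplex ℝ ι =>
      ∑ i, z.2.1 i * (metricAt (τ i) z.1.1).form ((chartFrame c z.1.1 z.1.2).symm v)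
        ((chartFrame c z.1.1 z.1.2).symm w) :=
    continuous_finsetSum _ fun i _ =>
      ((continuous_apply i).comp (continuous_subtype_val.comp continuous_snd)).mul
        ((continuous_metricAt_coord (τ i) c v w).comp continuous_fst)
  refine this.congr fun z => ?_
  simp [PosForm.push, convexMetric]

omit [IsManifold (𝓡 n) ∞ M] in
theorem exists_compact_nhds_chart (c : M) : ∃ B ∈ 𝓝 c, IsCompact B ∧
    B ⊆ (chartAt (EuclideanSpace ℝ (Fin n)) c).source := by
  have := ChartedSpace.locallyCompactSpace (EuclideanSpace ℝ (Fin n)) M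
  obtain ⟨B, hB, hs, hc⟩ := local_compact_nhds
    ((chartAt (EuclideanSpace ℝ (Fin n)) c).open_source.mem_nhds (mem_chart_source _ c))
  exact ⟨B, hB, hc, hs⟩

omit [IsManifold (𝓡 n) ∞ M] in
theorem isCompact_preimage_source {c : M} {B : Set M} (hB : IsCompact B)
    (hs : B ⊆ (chartAt (EuclideanSpace ℝ (Fin n)) c).source) :
    IsCompact ((↑) ⁻¹' B : Set (chartAt (EuclideanSpace ℝ (Fin n)) c).source) := by
  rw [Subtype.isCompact_iff, Subtype.image_preimage_coe, inter_eq_right.2 hs]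
  exact hB

/-- The convex combinations of finitely many smooth metrics on a compact manifold stay at bounded
distance of a given metric. -/
theorem exists_edist_convexMetric_le [CompactSpace M] (g₀ : SmoothMetric n M) {ι : Type*} [Fintype ι]
    (τ : ι → SmoothMetric n M) :
    ∃ D : NNReal, ∀ (p : M) (w : stdSimplex ℝ ι),
      edist (Fiber.of (metricAt g₀ p) (convexMetric τ w p) : EBar g₀ p) (toSection g₀ g₀ p) ≤ D := by
  have hloc : ∃ D : NNReal, ∀ p ∈ (univ : Set M), ∀ (w : stdSimplex ℝ ι),
      edist (Fiber.of (metricAt g₀ p) (convexMetric τ w p) : EBar g₀ p)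
        (toSection g₀ g₀ p) ≤ D := by
    -- The existence of a bound passes to subsets and to finite unions, so it is enough to find one
    -- near each point.
    refine isCompact_univ.induction_on (p := fun S => ∃ D : NNReal, ∀ p ∈ S,
      ∀ (w : stdSimplex ℝ ι), edist (Fiber.of (metricAt g₀ p) (convexMetric τ w p) : EBar g₀ p)
        (toSection g₀ g₀ p) ≤ D) ⟨0, by simp⟩ (fun S T hST ⟨D, hD⟩ => ⟨D, fun p hp => hD p (hST hp)⟩)
      (fun S T ⟨D, hD⟩ ⟨D', hD'⟩ => ⟨max D D', ?_⟩) fun c _ => ?_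
    · rintro p (hp | hp) w
      · exact (hD p hp w).trans (by simp)
      · exact (hD' p hp w).trans (by simp)
    · obtain ⟨B, hB, hBc, hBs⟩ := exists_compact_nhds_chart (n := n) c
      -- The bound from the chart is jointly continuous in the point and the weights, hence bounded
      -- on the compact product of `B` and the simplex.
      have hf : Continuous fun z : (chartAt (EuclideanSpace ℝ (Fin n)) c).source × stdSimplex ℝ ι =>
          chartLipschitz g₀ c z.1 * nndist (Fiber.of (euclideanForm n)
            ((convexMetric τ z.2 z.1.1).push (chartFrame c z.1.1 z.1.2).toLinearEquiv))
            (Fiber.of (euclideanForm n)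
              ((metricAt g₀ z.1.1).push (chartFrame c z.1.1 z.1.2).toLinearEquiv)) :=
        ((continuous_chartLipschitz g₀ c).comp continuous_fst).mul
          ((continuous_push_convexMetric τ c).nndist
            ((continuous_push_metricAt g₀ c).comp continuous_fst))
      have : CompactSpace (stdSimplex ℝ ι) := isCompact_iff_compactSpace.1 (isCompact_stdSimplex ℝ ι)
      obtain ⟨D, hD⟩ := ((isCompact_preimage_source hBc hBs).prod
        (isCompact_univ (X := stdSimplex ℝ ι))).bddAbove_image hf.continuousOn
      refine ⟨B, mem_nhdsWithin_of_mem_nhds hB, D, fun p hp w => ?_⟩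
      refine (edist_le_toModel g₀ c ⟨p, hBs hp⟩ _ _).trans ?_
      rw [toSection, toModel_coe, toModel_coe, UniformSpace.Completion.edist_eq, edist_nndist,
        ← ENNReal.coe_mul, ENNReal.coe_le_coe]
      exact hD ⟨(⟨p, hBs hp⟩, w), ⟨hp, mem_univ _⟩, rfl⟩
  obtain ⟨D, hD⟩ := hloc
  exact ⟨D, fun p w => hD p (mem_univ p) w⟩

theorem metricAt_eq_of_inner {g : SmoothMetric n M} {p : M} {h : PosForm (TangentSpace (𝓡 n) p)}
    (H : ∀ v w, g.inner p v w = h.form v w) : metricAt g p = h :=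
  PosForm.ext_form (by ext v w; exact H v w)

theorem exists_edist_toSection_le [CompactSpace M] (g₀ g : SmoothMetric n M) :
    ∃ D : NNReal, ∀ p : M, edist (toSection g₀ g p) (toSection g₀ g₀ p) ≤ D := by
  obtain ⟨D, hD⟩ := exists_edist_convexMetric_le g₀ (fun _ : Unit => g)
  refine ⟨D, fun p => ?_⟩
  have h := hD p ⟨fun _ => 1, by simp [stdSimplex]⟩
  convert h
  rw [toSection]
  congr 2
  exact PosForm.ext_form (by simp [convexMetric])

/-- Continuity gives measurability, and a bounded function is square integrable for a finite
measure. -/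
theorem isL2Section_toSection [CompactSpace M] [MeasurableSpace M] [BorelSpace M]
    (g₀ g : SmoothMetric n M) [IsFiniteMeasure (riemannianVolume g₀)] :
    IsL2Section g₀ (toSection g₀ g) := by
  refine ⟨?_, ?_⟩
  · have : BorelSpace (EBarTotal g₀) := ⟨rfl⟩
    exact (continuous_toSection g₀ g).measurable
  · obtain ⟨D, hD⟩ := exists_edist_toSection_le g₀ g
    calc ∫⁻ p, edist (toSection g₀ g p) (toSection g₀ g₀ p) ^ 2 ∂(riemannianVolume g₀)
        ≤ ∫⁻ _, (D : ℝ≥0∞) ^ 2 ∂(riemannianVolume g₀) :=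
          lintegral_mono fun p => pow_le_pow_left' (hD p) 2
      _ < ⊤ := by
        rw [lintegral_const]
        exact ENNReal.mul_lt_top (by simp) (measure_lt_top _ _)

/-! ### Gluing and extending smooth metrics. -/

variable [T2Space M] [CompactSpace M]

/-- Finitely many smooth metrics can be glued along disjoint closed sets. -/
theorem exists_smoothMetric_eqOn {ι : Type*} [Fintype ι] [Nonempty ι] (τ : ι → SmoothMetric n M)
    (K : ι → Set M) (hK : ∀ i, IsClosed (K i)) (hd : Pairwise (Function.onFun Disjoint K)) :
    ∃ g : SmoothMetric n M, (∀ p, ∃ w : stdSimplex ℝ ι, metricAt g p = convexMetric τ w p) ∧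
      ∀ i, ∀ p ∈ K i, metricAt g p = metricAt (τ i) p := by
  classical
  let L (p : M) : (ι → ℝ) →ₗ[ℝ] BilinFiber n p :=
    Fintype.linearCombination ℝ fun i => (τ i).inner p
  have hL (p : M) (w : ι → ℝ) : L p w = ∑ i, w i • (τ i).inner p := rfl
  have hLf (p : M) (w : ι → ℝ) (hw : w ∈ stdSimplex ℝ ι) (u v : TangentSpace (𝓡 n) p) :
      L p w u v = (convexMetric τ ⟨w, hw⟩ p).form u v := by
    simp [hL, convexMetric, metricAt]
  have hsingle (i : ι) (p : M) : (τ i).inner p = L p (Pi.single i 1) := by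
    simp [hL, Pi.single_apply]
  -- The admissible values at `p` are the convex combinations of the `τ i`, with the value
  -- prescribed when `p` lies in some `K i`. Both conditions are convex.
  suffices h : ∃ g : SmoothMetric n M, ∀ p, g.inner p ∈
      L p '' stdSimplex ℝ ι ∩ {φ | ∀ i, p ∈ K i → φ = (τ i).inner p} by
    obtain ⟨g, hg⟩ := h
    refine ⟨g, fun p => ?_, fun i p hp => ?_⟩
    · obtain ⟨⟨w, hw, hwg⟩, -⟩ := hg p
      refine ⟨⟨w, hw⟩, metricAt_eq_of_inner fun u v => ?_⟩
      rw [← hwg, hLf p w hw]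
    · refine metricAt_eq_of_inner fun u v => ?_
      rw [(hg p).2 i hp]; rfl
  refine exists_smoothMetric_mem _
    (fun p => ((convex_stdSimplex ℝ ι).linear_image _).inter ?_) ?_ ?_ fun p₀ => ?_
  · intro φ hφ ψ hψ a b _ _ hab i hi
    rw [hφ i hi, hψ i hi, ← add_smul, hab, one_smul]
  · rintro p _ ⟨⟨w, hw, rfl⟩, -⟩ u v
    rw [hLf p w hw, hLf p w hw, PosForm.symm]
  · rintro p _ ⟨⟨w, hw, rfl⟩, -⟩ v hv
    rw [hLf p w hw]
    exact PosForm.pos _ v hv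
  · obtain ⟨i, hi⟩ : ∃ i, ∀ j, j ≠ i → p₀ ∉ K j := by
      by_cases h : ∃ i, p₀ ∈ K i
      · obtain ⟨i, hi⟩ := h
        exact ⟨i, fun j hj hpj => Set.disjoint_left.1 (hd hj) hpj hi⟩
      · exact ⟨Classical.arbitrary ι, fun j _ hpj => h ⟨j, hpj⟩⟩
    refine ⟨⋂ j, ⋂ (_ : j ≠ i), (K j)ᶜ, ?_, (τ i).inner, (τ i).contMDiff.contMDiffOn,
      fun p hp => ⟨⟨_, single_mem_stdSimplex ℝ i, (hsingle i p).symm⟩, fun j hj => ?_⟩⟩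
    · rw [Filter.iInter_mem]
      intro j
      rw [Filter.iInter_mem]
      exact fun hj => (hK j).isOpen_compl.mem_nhds (hi j hj)
    · simp only [mem_iInter] at hp
      by_cases hji : j = i
      · rw [hji]
      · exact absurd hj (hp j hji)

/-- A metric which is constant in a chart near a given point extends to a smooth metric. -/
theorem exists_smoothMetric_eq_chart (g₀ : SmoothMetric n M) (c : M) {B : Set M} (hB : IsClosed B)
    (hs : B ⊆ (chartAt (EuclideanSpace ℝ (Fin n)) c).source)
    (H : PosForm (EuclideanSpace ℝ (Fin n))) :
    ∃ g : SmoothMetric n M, ∀ (p) (hp : p ∈ B),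
      metricAt g p = H.push (chartFrame c p (hs hp)).toLinearEquiv.symm := by
  suffices h : ∃ g : SmoothMetric n M, ∀ p, g.inner p ∈
      {φ : BilinFiber n p | (∀ v w, φ v w = φ w v) ∧ (∀ v, v ≠ 0 → 0 < φ v v) ∧
        (p ∈ B → φ = chartPull c H p)} by
    obtain ⟨g, hg⟩ := h
    refine ⟨g, fun p hp => metricAt_eq_of_inner fun v w => ?_⟩
    rw [(hg p).2.2 hp, chartPull_apply c H (hs hp)]
  refine exists_smoothMetric_mem _ (fun p => ?_) (fun p φ hφ => hφ.1) (fun p φ hφ => hφ.2.1)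
    fun p₀ => ?_
  · intro φ hφ ψ hψ a b ha hb hab
    refine ⟨fun v w => ?_, fun v hv => ?_, fun hp => ?_⟩
    · simp [hφ.1 v w, hψ.1 v w]
    · have h1 := hφ.2.1 v hv
      have h2 := hψ.2.1 v hv
      simp only [add_apply, smul_apply, smul_eq_mul]
      rcases ha.eq_or_lt with rfl | ha
      · rw [zero_add] at hab; simpa [hab] using h2
      · have := mul_pos ha h1
        have := mul_nonneg hb h2.le
        linarith
    · rw [hφ.2.2 hp, hψ.2.2 hp, ← add_smul, hab, one_smul]
  -- Around points of `B` the chart-constant form is admissible on the whole chart domain; elsewhere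
  -- `g₀` is, on the open complement of `B`.
  · by_cases hp₀ : p₀ ∈ B
    · refine ⟨_, (chartAt (EuclideanSpace ℝ (Fin n)) c).open_source.mem_nhds (hs hp₀), _,
        contMDiffOn_chartPull c H, fun p hp => ⟨fun v w => ?_, fun v hv => ?_, fun _ => rfl⟩⟩
      · rw [chartPull_apply c H hp, chartPull_apply c H hp, PosForm.symm]
      · rw [chartPull_apply c H hp]
        exact PosForm.pos _ v hv
    · exact ⟨Bᶜ, hB.isOpen_compl.mem_nhds hp₀, g₀.inner, g₀.contMDiff.contMDiffOn,
        fun p hp => ⟨g₀.symm p, g₀.pos p, fun h => absurd h hp⟩⟩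

end Sections

/-! ### Approximation of square integrable sections. -/

section Density

variable {n : ℕ} {M : Type*} [TopologicalSpace M] [ChartedSpace (EuclideanSpace ℝ (Fin n)) M]
  [IsManifold (𝓡 n) ∞ M] [MeasurableSpace M] [BorelSpace M]

omit [BorelSpace M] in
-- The set is the preimage under the section of a basic open set of `Ē`, with `W` equal to the whole
-- manifold.
theorem measurableSet_toModel_mem {g₀ : SmoothMetric n M} {σ : ∀ p : M, EBar g₀ p}
    (hσ : Measurable (sectionMap σ)) (c : M) {O : Set (ModelFiber n)} (hO : IsOpen O) :
    MeasurableSet {p | ∃ hp : p ∈ (chartAt (EuclideanSpace ℝ (Fin n)) c).source,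
      toModel g₀ c p hp (σ p) ∈ O} := by
  have : BorelSpace (EBarTotal g₀) := ⟨rfl⟩
  have hS : IsOpen {v : EBarTotal g₀ | v.1 ∈ (univ : Set M) ∧
      ∃ hp : v.1 ∈ (chartAt (EuclideanSpace ℝ (Fin n)) c).source, toModel g₀ c v.1 hp v.2 ∈ O} :=
    TopologicalSpace.isOpen_generateFrom_of_mem ⟨c, univ, O, isOpen_univ, hO, rfl⟩
  convert hσ hS.measurableSet using 1
  ext p
  simp only [mem_preimage, mem_ofPred_eq, mem_univ, true_and]
  rfl

variable [T2Space M] [CompactSpace M]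

/-- A measurable section is, on each set of a countable measurable cover, uniformly close to a
smooth metric. -/
theorem exists_cover_edist_toSection_le [Nonempty M] {g₀ : SmoothMetric n M}
    {σ : ∀ p : M, EBar g₀ p} (hσ : Measurable (sectionMap σ)) {r : NNReal} (hr : 0 < r) :
    ∃ (E : ℕ → Set M) (τ : ℕ → SmoothMetric n M), (∀ k, MeasurableSet (E k)) ∧ (⋃ k, E k) = univ ∧
      ∀ k, ∀ p ∈ E k, edist (σ p) (toSection g₀ (τ k) p) ≤ r := by
  have : Nonempty (Fiber (euclideanForm n)) := ⟨euclideanForm n⟩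
  choose B hB hBc hBs using exists_compact_nhds_chart (n := n) (M := M)
  choose L hL using fun c => ((isCompact_preimage_source (hBc c) (hBs c)).bddAbove_image
    (continuous_chartLipschitz g₀ c).continuousOn)
  -- `τ c k` is a global metric that is, on `B c`, the `k`-th form of the dense sequence in the
  -- coordinates of the chart.
  choose τ hτ using fun (c : M) (k : ℕ) => exists_smoothMetric_eq_chart g₀ c (hBc c).isClosed
    (hBs c) (TopologicalSpace.denseSeq (Fiber (euclideanForm n)) k)
  obtain ⟨t, -, ht⟩ := isCompact_univ.elim_nhds_subcover B fun c _ => hB c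
  have : Nonempty t := by
    obtain ⟨c, hc, -⟩ := mem_iUnion₂.1 (ht (mem_univ (Classical.arbitrary M)))
    exact ⟨⟨c, hc⟩⟩
  obtain ⟨f, hf⟩ := exists_surjective_nat (t × ℕ)
  -- A ball of radius `r / (L c + 1)` in coordinates is carried to distances at most `r`; the `+ 1`
  -- keeps the divisor positive.
  let O (c : M) (k : ℕ) : Set (ModelFiber n) :=
    Metric.eball ((TopologicalSpace.denseSeq (Fiber (euclideanForm n)) k :
      Fiber (euclideanForm n)) : ModelFiber n) (r / (L c + 1) : NNReal)
  have hδ (c : M) : 0 < r / (L c + 1) := div_pos hr (by positivity)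
  refine ⟨fun k => B (f k).1 ∩ {p | ∃ hp : p ∈ (chartAt (EuclideanSpace ℝ (Fin n)) (f k).1.1).source,
      toModel g₀ (f k).1 p hp (σ p) ∈ O (f k).1 (f k).2}, fun k => τ (f k).1 (f k).2,
    fun k => (hBc _).measurableSet.inter (measurableSet_toModel_mem hσ _ Metric.isOpen_eball), ?_, ?_⟩
  · refine eq_univ_of_forall fun p => ?_
    obtain ⟨c, hct, hc⟩ := mem_iUnion₂.1 (ht (mem_univ p))
    have hd : DenseRange fun k : ℕ => ((TopologicalSpace.denseSeq (Fiber (euclideanForm n)) k :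
        Fiber (euclideanForm n)) : ModelFiber n) :=
      UniformSpace.Completion.denseRange_coe.comp (TopologicalSpace.denseRange_denseSeq _)
        (UniformSpace.Completion.continuous_coe _)
    obtain ⟨k, hk⟩ := hd.exists_mem_open (Metric.isOpen_eball
        (x := toModel g₀ c p (hBs c hc) (σ p)) (ε := ((r / (L c + 1) : NNReal) : ℝ≥0∞)))
      ⟨_, Metric.mem_eball_self (ENNReal.coe_pos.2 (hδ c))⟩
    obtain ⟨m, hm⟩ := hf (⟨c, hct⟩, k)
    refine mem_iUnion.2 ⟨m, ?_⟩
    simp only [hm]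
    exact ⟨hc, hBs c hc, Metric.mem_eball_comm.1 hk⟩
  · rintro k p ⟨hpB, hp, hpO⟩
    set c := (f k).1.1
    have h1 := edist_le_toModel g₀ c ⟨p, hp⟩ (σ p) (toSection g₀ (τ c (f k).2) p)
    have h2 : toModel g₀ c p hp (toSection g₀ (τ c (f k).2) p) =
        ((TopologicalSpace.denseSeq (Fiber (euclideanForm n)) (f k).2 :
          Fiber (euclideanForm n)) : ModelFiber n) := by
      rw [toSection, toModel_coe, hτ c _ p hpB]
      exact congrArg _ (PosForm.push_push_symm (chartFrame c p hp).toLinearEquiv.symm _)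
    rw [h2] at h1
    refine h1.trans ?_
    have h3 : chartLipschitz g₀ c ⟨p, hp⟩ ≤ L c := hL c ⟨⟨p, hp⟩, hpB, rfl⟩
    have h4 : edist (toModel g₀ c p hp (σ p)) _ ≤ ((r / (L c + 1) : NNReal) : ℝ≥0∞) :=
      (Metric.mem_eball.1 hpO).le
    calc _ ≤ (L c : ℝ≥0∞) * ((r / (L c + 1) : NNReal) : ℝ≥0∞) := by gcongr
      _ ≤ r := by
        rw [← ENNReal.coe_mul, ENNReal.coe_le_coe, mul_div_assoc', div_le_iff₀ (by positivity),
          mul_comm]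
        gcongr
        exact le_self_add

/-- Finitely many smooth metrics, given on disjoint measurable sets, are equal to a smooth
metric outside a set of small measure. -/
theorem exists_smoothMetric_eq_compl (μ : Measure M) [IsFiniteMeasure μ] {ι : Type*} [Fintype ι]
    [Nonempty ι] (τ : ι → SmoothMetric n M) (A : ι → Set M) (hA : ∀ i, MeasurableSet (A i))
    (hd : Pairwise (Function.onFun Disjoint A)) {η : ℝ≥0∞} (hη : η ≠ 0) :
    ∃ (g : SmoothMetric n M) (R : Set M), MeasurableSet R ∧ μ R ≤ η ∧
      (∀ p, ∃ w : stdSimplex ℝ ι, metricAt g p = convexMetric τ w p) ∧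
      ∀ i, ∀ p ∈ A i, p ∉ R → metricAt g p = metricAt (τ i) p := by
  -- Metrizability provides the inner regularity by compact sets; each of the finitely many pieces
  -- may lose an equal share of `η`.
  have := Manifold.metrizableSpace (𝓡 n) M
  have hη' : η / Fintype.card ι ≠ 0 := by simp [hη]
  choose K hKA hKc hKμ using fun i => (hA i).exists_isCompact_sdiff_lt (measure_ne_top μ _) hη'
  obtain ⟨g, hg, hgK⟩ := exists_smoothMetric_eqOn τ K (fun i => (hKc i).isClosed)
    fun i j hij => (hd hij).mono (hKA i) (hKA j)
  refine ⟨g, ⋃ i, A i \ K i, MeasurableSet.iUnion fun i => (hA i).diff (hKc i).measurableSet, ?_,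
    hg, fun i p hp hpR => hgK i p ?_⟩
  · calc μ (⋃ i, A i \ K i) ≤ ∑ i, μ (A i \ K i) := measure_iUnion_fintype_le _ _
      _ ≤ ∑ _i : ι, η / Fintype.card ι := Finset.sum_le_sum fun i _ => (hKμ i).le
      _ = η := by
        rw [Finset.sum_const, Finset.card_univ, nsmul_eq_mul]
        exact ENNReal.mul_div_cancel (by simp) (by simp)
  · by_contra hpK
    exact hpR (mem_iUnion.2 ⟨i, hp, hpK⟩)

theorem add_sq_le_four_mul_sq_add (a b : ℝ≥0∞) : (a + b) ^ 2 ≤ 4 * a ^ 2 + 4 * b ^ 2 := by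
  have h : (a + b) ^ 2 ≤ (2 * max a b) ^ 2 := by
    gcongr
    rw [two_mul]
    exact add_le_add (le_max_left _ _) (le_max_right _ _)
  refine h.trans ?_
  rcases max_cases a b with ⟨h, -⟩ | ⟨h, -⟩ <;> rw [h, mul_pow] <;> norm_num

/-- Smooth metrics are dense among the square integrable sections. -/
theorem exists_lintegral_edist_toSection_le {g₀ : SmoothMetric n M}
    [IsProbabilityMeasure (riemannianVolume g₀)] {σ : ∀ p : M, EBar g₀ p} (hσ : IsL2Section g₀ σ)
    {r : NNReal} (hr : 0 < r) :
    ∃ g : SmoothMetric n M,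
      ∫⁻ p, edist (σ p) (toSection g₀ g p) ^ 2 ∂(riemannianVolume g₀) ≤ 3 * (r : ℝ≥0∞) ^ 2 := by
  set μ := riemannianVolume g₀
  have : Nonempty M := nonempty_of_isProbabilityMeasure μ
  obtain ⟨E, τ, hE, hEU, hτ⟩ := exists_cover_edist_toSection_le hσ.measurable hr
  have hr0 : (r : ℝ≥0∞) ^ 2 ≠ 0 := by simp [hr.ne']
  -- Absolute continuity of the integral; the `4` cancels the factor from
  -- `add_sq_le_four_mul_sq_add`.
  obtain ⟨δ, hδ0, hδ⟩ := exists_pos_setLIntegral_lt_of_measure_lt hσ.lintegral_lt_top.ne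
    (ε := (r : ℝ≥0∞) ^ 2 / 4) (by simpa using hr.ne')
  have hδ2 : 0 < δ / 2 := ENNReal.half_pos hδ0.ne'
  obtain ⟨N, hN⟩ : ∃ N : ℕ, μ (⋃ k : Fin N, E k)ᶜ < δ / 2 := by
    have ht := tendsto_measure_iInter_atTop (μ := μ) (s := fun N : ℕ => (⋃ k : Fin N, E k)ᶜ)
      (fun N => (MeasurableSet.iUnion fun k : Fin N => hE k).compl.nullMeasurableSet)
      (fun N N' hN => compl_subset_compl.2 (iUnion_subset fun k =>
        subset_iUnion (fun k : Fin N' => E k) ⟨k, k.2.trans_le hN⟩)) ⟨0, measure_ne_top _ _⟩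
    have he : (⋂ N : ℕ, (⋃ k : Fin N, E k)ᶜ) = ∅ := by
      rw [← compl_iUnion, compl_empty_iff]
      refine eq_univ_of_forall fun p => ?_
      obtain ⟨k, hk⟩ := mem_iUnion.1 (hEU ▸ mem_univ p)
      exact mem_iUnion.2 ⟨k + 1, mem_iUnion.2 ⟨⟨k, k.lt_succ_self⟩, hk⟩⟩
    rw [he, measure_empty] at ht
    exact (ht.eventually_lt_const hδ2).exists
  -- `none` labels the part not covered by the first `N` sets, where `g₀` is used; the other pieces
  -- are made disjoint.
  let A : Option (Fin N) → Set M := fun o => o.elim (⋃ k : Fin N, E k)ᶜ fun k => disjointed E k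
  let T : Option (Fin N) → SmoothMetric n M := fun o => o.elim g₀ fun k => τ k
  have hsub (k : Fin N) : disjointed E k ⊆ ⋃ k : Fin N, E k :=
    (disjointed_subset E k).trans (subset_iUnion (fun k : Fin N => E k) k)
  have hA (o) : MeasurableSet (A o) := by
    cases o with
    | none => exact (MeasurableSet.iUnion fun k : Fin N => hE k).compl
    | some k => exact MeasurableSet.disjointed hE k
  have hAd : Pairwise (Function.onFun Disjoint A) := by
    rintro (_ | i) (_ | j) hij
    · exact absurd rfl hij
    · exact disjoint_compl_left.mono_right (hsub j)
    · exact disjoint_compl_right.mono_left (hsub i)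
    · exact disjoint_disjointed E fun h => hij (by rw [Fin.ext h])
  have hAU : (⋃ o, A o) = univ := by
    refine eq_univ_of_forall fun p => ?_
    by_cases hp : p ∈ ⋃ k : Fin N, E k
    · obtain ⟨k, hk⟩ := mem_iUnion.1 hp
      have : p ∈ ⋃ j ∈ Finset.range (k + 1), disjointed E j := by
        rw [biUnion_range_succ_disjointed]
        exact le_partialSups E k hk
      obtain ⟨j, hj, hpj⟩ := mem_iUnion₂.1 this
      have hjN : j < N := (Finset.mem_range_succ_iff.1 hj).trans_lt k.2
      exact mem_iUnion.2 ⟨some ⟨j, hjN⟩, hpj⟩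
    · exact mem_iUnion.2 ⟨none, hp⟩
  obtain ⟨D, hD⟩ := exists_edist_convexMetric_le g₀ T
  have hD0 : (4 * (D : ℝ≥0∞) ^ 2 + 1) ≠ 0 := by simp
  have hDT : (4 * (D : ℝ≥0∞) ^ 2 + 1) ≠ ⊤ := by finiteness
  -- `D` is already fixed. The bound `δ / 4` keeps the measure of `A none ∪ R` below `δ`, and the
  -- other bound gives `4 * D ^ 2 * μ R ≤ r ^ 2`, with `+ 1` excluding a zero divisor.
  obtain ⟨g, R, hR, hRμ, hgw, hgA⟩ := exists_smoothMetric_eq_compl μ T A hA hAd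
    (η := min (δ / 4) ((r : ℝ≥0∞) ^ 2 / (4 * (D : ℝ≥0∞) ^ 2 + 1))) (by
      rw [← pos_iff_ne_zero, lt_min_iff]
      exact ⟨ENNReal.div_pos hδ0.ne' (by simp), ENNReal.div_pos hr0 hDT⟩)
  refine ⟨g, ?_⟩
  let S := A none ∪ R
  let F : M → ℝ≥0∞ := fun p => edist (σ p) (toSection g₀ g₀ p) ^ 2
  have hS : MeasurableSet S := (hA none).union hR
  have hSF : ∫⁻ p in S, F p ∂μ < (r : ℝ≥0∞) ^ 2 / 4 := by
    refine hδ S ((measure_union_le _ _).trans_lt ?_)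
    calc μ (A none) + μ R < δ / 2 + δ / 2 :=
          ENNReal.add_lt_add_of_lt_of_le (measure_ne_top _ _) hN
            ((hRμ.trans (min_le_left _ _)).trans (by gcongr; norm_num))
      _ = δ := ENNReal.add_halves δ
  -- On `R` the triangle inequality through `g₀` is used. Off `R`, `g` is either `g₀`, giving `F p`,
  -- or one of the `τ k`, giving at most `r ^ 2`.
  have hpt (p : M) : edist (σ p) (toSection g₀ g p) ^ 2 ≤
      ((r : ℝ≥0∞) ^ 2 + R.indicator (fun _ => 4 * (D : ℝ≥0∞) ^ 2) p) +
        S.indicator (fun p => 4 * F p) p := by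
    by_cases hpR : p ∈ R
    · have hpS : p ∈ S := Or.inr hpR
      obtain ⟨w, hw⟩ := hgw p
      have h1 : edist (toSection g₀ g₀ p) (toSection g₀ g p) ≤ D := by
        rw [edist_comm, toSection, hw]
        exact hD p w
      rw [indicator_of_mem hpR, indicator_of_mem hpS]
      calc edist (σ p) (toSection g₀ g p) ^ 2
          ≤ (edist (σ p) (toSection g₀ g₀ p) + D) ^ 2 := by
            gcongr
            exact (edist_triangle _ (toSection g₀ g₀ p) _).trans (by gcongr)
        _ ≤ 4 * F p + 4 * (D : ℝ≥0∞) ^ 2 := add_sq_le_four_mul_sq_add _ _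
        _ ≤ _ := by rw [add_comm, add_assoc]; exact le_add_self
    · obtain ⟨o, ho⟩ := mem_iUnion.1 (hAU ▸ mem_univ p)
      have hgp : toSection g₀ g p = toSection g₀ (T o) p := by
        rw [toSection, hgA o p ho hpR, toSection]
      rw [hgp]
      cases o with
      | none =>
        rw [indicator_of_mem (s := S) (Or.inl ho)]
        refine le_trans ?_ le_add_self
        exact le_mul_of_one_le_left' (a := F p) (by norm_num)
      | some k =>
        refine le_trans ?_ (le_add_right le_self_add)
        gcongr
        exact hτ k p (disjointed_subset E k ho)
  calc ∫⁻ p, edist (σ p) (toSection g₀ g p) ^ 2 ∂μ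
      ≤ ∫⁻ p, (((r : ℝ≥0∞) ^ 2 + R.indicator (fun _ => 4 * (D : ℝ≥0∞) ^ 2) p) +
        S.indicator (fun p => 4 * F p) p) ∂μ := lintegral_mono hpt
    _ = (r : ℝ≥0∞) ^ 2 + 4 * (D : ℝ≥0∞) ^ 2 * μ R + 4 * ∫⁻ p in S, F p ∂μ := by
      have hm : Measurable fun p => (r : ℝ≥0∞) ^ 2 +
          R.indicator (fun _ => 4 * (D : ℝ≥0∞) ^ 2) p :=
        (measurable_const (a := (r : ℝ≥0∞) ^ 2)).add
          ((measurable_const (a := 4 * (D : ℝ≥0∞) ^ 2)).indicator hR)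
      rw [lintegral_add_left hm, lintegral_add_left measurable_const, lintegral_indicator hS, lintegral_indicator hR,
        lintegral_const_mul' 4 F (by simp), lintegral_const, lintegral_const, measure_univ,
        mul_one, Measure.restrict_apply_univ]
    _ ≤ (r : ℝ≥0∞) ^ 2 + (r : ℝ≥0∞) ^ 2 + (r : ℝ≥0∞) ^ 2 := by
      gcongr
      · calc 4 * (D : ℝ≥0∞) ^ 2 * μ R
            ≤ (4 * (D : ℝ≥0∞) ^ 2 + 1) * ((r : ℝ≥0∞) ^ 2 / (4 * (D : ℝ≥0∞) ^ 2 + 1)) := by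
              gcongr
              · exact le_self_add
              · exact hRμ.trans (min_le_right _ _)
          _ = (r : ℝ≥0∞) ^ 2 := ENNReal.mul_div_cancel hD0 hDT
      · calc 4 * ∫⁻ p in S, F p ∂μ ≤ 4 * ((r : ℝ≥0∞) ^ 2 / 4) := by gcongr
          _ = (r : ℝ≥0∞) ^ 2 := ENNReal.mul_div_cancel (by simp) (by simp)
    _ = 3 * (r : ℝ≥0∞) ^ 2 := by ring

end Density

end EbinL2

end


theorem mainTheorem4 (n : ℕ) {M : Type*} [TopologicalSpace M]
    [ChartedSpace (EuclideanSpace ℝ (Fin n)) M] [IsManifold (𝓡 n) ∞ M] [T2Space M] [CompactSpace M]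
    [MeasurableSpace M] [BorelSpace M] (g₀ : EbinL2.SmoothMetric n M)
    (hvol : EbinL2.riemannianVolume g₀ Set.univ = 1) :
    ∃ hL2 : ∀ g : EbinL2.SmoothMetric n M, EbinL2.IsL2Section g₀ (EbinL2.toSection g₀ g),
      ∀ s : EbinL2.EBarL2 g₀, ∀ ε : ℝ, 0 < ε → ∃ g : EbinL2.SmoothMetric n M,
        EbinL2.EBarL2.d s (EbinL2.EBarL2.mk (EbinL2.toSection g₀ g) (hL2 g)) <
          ENNReal.ofReal ε := by
  have hprob : IsProbabilityMeasure (EbinL2.riemannianVolume g₀) := ⟨hvol⟩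
  refine ⟨fun g => EbinL2.isL2Section_toSection g₀ g, fun s ε hε => ?_⟩
  obtain ⟨⟨σ, hσ⟩, rfl⟩ := Quotient.exists_rep s
  -- With `r = ε / 2` the squared error is at most `3 * ε ^ 2 / 4 < ε ^ 2`.
  obtain ⟨g, hg⟩ := EbinL2.exists_lintegral_edist_toSection_le hσ
    (r := (ε / 2).toNNReal) (Real.toNNReal_pos.2 (half_pos hε))
  refine ⟨g, ?_⟩
  change (∫⁻ p, edist (σ p) (EbinL2.toSection g₀ g p) ^ 2
    ∂(EbinL2.riemannianVolume g₀)) ^ (1 / 2 : ℝ) < _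
  rw [one_div, ENNReal.rpow_inv_lt_iff two_pos]
  refine hg.trans_lt ?_
  change 3 * ENNReal.ofReal (ε / 2) ^ 2 < _
  rw [ENNReal.rpow_two, ← ENNReal.ofReal_pow hε.le, ← ENNReal.ofReal_pow (half_pos hε).le,
    ← ENNReal.ofReal_ofNat 3, ← ENNReal.ofReal_mul (by norm_num)]
  refine (ENNReal.ofReal_lt_ofReal_iff (by positivity)).2 ?_
  nlinarith [sq_pos_of_pos hε]
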